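/- Let $q\geqslant 4$ be a prime power and let $n=q^2+q+1$. Enumerate the points of $\mathbb{P}^2$ over $\mathbb{F}_q$ by $E=\{1,\dots,n\}$, and let $C_q\subset\mathbb{F}_q^{\,n}$ be the Veronese code, that is, the row space of the $6\times n$ matrix $G_q$ whose $e$-th column is a coordinate $6$-tuple of the image of the $e$-th point under the Veronese map $(x:y:z)\mapsto(x^2:xy:xz:y^2:yz:z^2)$, $\mathbb{P}^2\to\mathbb{P}^5$. Let $H$ be a parity check matrix of $C_q$, and let $M_q$ be the matroid on $E$ in which a subset is independent if and only if the columns of $H$ indexed by it are linearly independent over $\mathbb{F}_q$. For a field $K$, let $R=K[X_e : e\in E]$, and let $I\subset R$ be the Stanley–Reisner ideal of $M_q$, generated by the monomials $\prod_{e\in\sigma}X_e$ for the dependent sets $\sigma$ of $M_q$. Let $\beta^{(0)}_{i,\alpha}$ ($\alpha\in\mathbb{N}^n$) and $\beta^{(0)}_{i,j}$ ($j\in\mathbb{N}$) be the Betti numbers of $M_q$: the number of summands $R(-\alpha)$, respectively $R(-j)$, in homological degree $i$ of a minimal $\mathbb{N}^n$-graded, respectively $\mathbb{N}$-graded, free resolution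 of $R/I$. Such resolutions exist, and the following numbers do not depend on the choice of the resolution, of the coordinate tuples, of $H$, or of $K$. For $\sigma\subset E$ write $\beta^{(0)}_{i,\sigma}$ for $\beta^{(0)}_{i,\alpha}$ with $\alpha$ the indicator vector of $\sigma$. (1) If $X\subset E$ consists of $q+1$ points on a line of $\mathbb{P}^2$ together with one point outside this line, then $$\beta^{(0)}_{2,\,E\setminus X}=q.$$ (2) Moreover, $$\beta^{(0)}_{2,\,q^2-1}=q^3(q^2+q+1).$$ -/

import Mathlib

open scoped Matrix LinearAlgebra.Projectivization

noncomputable section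

/-! ### The Veronese surface and the Veronese code -/

/-- The coordinates `(x², xy, xz, y², yz, z²)` of the image of `(x, y, z)` under the Veronese map. -/
def veroneseVec {F : Type*} [Field F] (x : Fin 3 → F) : Fin 6 → F :=
  ![x 0 ^ 2, x 0 * x 1, x 0 * x 2, x 1 ^ 2, x 1 * x 2, x 2 ^ 2]

theorem veroneseVec_ne_zero {F : Type*} [Field F] {x : Fin 3 → F} (hx : x ≠ 0) :
    veroneseVec x ≠ 0 := by
  intro h
  apply hx
  have h0 : x 0 ^ 2 = 0 := congrFun h 0
  have h1 : x 1 ^ 2 = 0 := congrFun h 3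
  have h2 : x 2 ^ 2 = 0 := congrFun h 5
  funext i
  fin_cases i
  · exact pow_eq_zero_iff (two_ne_zero) |>.1 h0
  · exact pow_eq_zero_iff (two_ne_zero) |>.1 h1
  · exact pow_eq_zero_iff (two_ne_zero) |>.1 h2

theorem veroneseVec_smul {F : Type*} [Field F] (c : F) (x : Fin 3 → F) :
    veroneseVec (c • x) = c ^ 2 • veroneseVec x := by
  funext i
  fin_cases i <;> simp [veroneseVec] <;> ring

/-- The Veronese map `ℙ² → ℙ⁵` over `F`. -/
def veronese {F : Type*} [Field F] (p : ℙ F (Fin 3 → F)) : ℙ F (Fin 6 → F) :=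
  Projectivization.mk F (veroneseVec p.rep) (veroneseVec_ne_zero p.rep_nonzero)

/-- The Veronese map may be computed from any homogeneous coordinates of the point. -/
theorem veronese_mk {F : Type*} [Field F] (x : Fin 3 → F) (hx : x ≠ 0) :
    veronese (Projectivization.mk F x hx) =
      Projectivization.mk F (veroneseVec x) (veroneseVec_ne_zero hx) := by
  obtain ⟨a, ha⟩ := Projectivization.exists_smul_eq_mk_rep F x hx
  refine (Projectivization.mk_eq_mk_iff F _ _ _ _).2 ⟨a ^ 2, ?_⟩
  rw [← ha, Units.smul_def, Units.smul_def, veroneseVec_smul, Units.val_pow_eq_pow_val]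

/-- `G` is a generator matrix `G_q` of the Veronese code with respect to the enumeration `P` of
the points of `ℙ²`: its `e`-th column is a (freely chosen) coordinate `6`-tuple of the image of
the `e`-th point under the Veronese map. -/
def IsVeroneseGeneratorMatrix {F E : Type*} [Field F] (P : E ≃ ℙ F (Fin 3 → F))
    (G : Matrix (Fin 6) E F) : Prop :=
  ∀ e, ∃ h : G.col e ≠ 0, Projectivization.mk F (G.col e) h = veronese (P e)

/-- The linear code with generator matrix `G`: the row space of `G`. -/
def rowCode {F m E : Type*} [Field F] (G : Matrix m E F) : Submodule F (E → F) :=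
  Submodule.span F (Set.range G.row)

/-- `H` is a parity check matrix of the code `C`: the code words are the vectors `c` with
`H c = 0`. -/
def IsParityCheckMatrix {F m E : Type*} [Field F] [Fintype E] (H : Matrix m E F)
    (C : Submodule F (E → F)) : Prop :=
  ∀ c : E → F, c ∈ C ↔ H *ᵥ c = 0

/-! ### The matroid of the columns of a matrix -/

theorem linearIndepOn_augment {F V E : Type*} [Field F] [AddCommGroup V] [Module F V] [Finite E]
    (v : E → V) {I J : Set E} (hI : LinearIndepOn F v I) (hJ : LinearIndepOn F v J)
    (hlt : I.ncard < J.ncard) : ∃ e ∈ J, e ∉ I ∧ LinearIndepOn F v (insert e I) := by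
  by_contra! hcon
  have hsub : v '' J ⊆ Submodule.span F (v '' I) := by
    rintro _ ⟨e, heJ, rfl⟩
    by_cases heI : e ∈ I
    · exact Submodule.subset_span ⟨e, heI, rfl⟩
    · by_contra hns
      exact hcon e heJ heI (hI.insert hns)
  have hle : Submodule.span F (v '' J) ≤ Submodule.span F (v '' I) := Submodule.span_le.2 hsub
  have hcard : ∀ {S : Set E}, LinearIndepOn F v S →
      Module.finrank F (Submodule.span F (v '' S)) = S.ncard := by
    intro S hS
    have : Fintype S := Fintype.ofFinite S
    have h := finrank_span_eq_card (R := F) (b := fun i : S => v i) hS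
    rw [Set.image_eq_range, h, ← Nat.card_eq_fintype_card, Nat.card_coe_set_eq]
  have : Module.Finite F (Submodule.span F (v '' I)) :=
    Module.Finite.span_of_finite F (Set.toFinite _)
  have := Submodule.finrank_mono hle
  rw [hcard hI, hcard hJ] at this
  omega

/-- The matroid on the index set `E` of the columns of `H`, in which a set is independent if and
only if the columns indexed by it are linearly independent. For a parity check matrix `H` of a
code `C` this is the matroid `M_C`. -/
def columnMatroid {F m E : Type*} [Field F] [Finite E] (H : Matrix m E F) : Matroid E :=
  (IndepMatroid.ofFinite (E := Set.univ) Set.finite_univ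
    (fun S => LinearIndepOn F H.col S)
    (linearIndepOn_empty F H.col)
    (fun _ _ hJ hIJ => hJ.mono hIJ)
    (fun _ _ hI hJ h => linearIndepOn_augment H.col hI hJ h)
    (fun _ _ => Set.subset_univ _)).matroid

theorem columnMatroid_indep_iff {F m E : Type*} [Field F] [Finite E] (H : Matrix m E F)
    (S : Set E) : (columnMatroid H).Indep S ↔ LinearIndepOn F H.col S :=
  Iff.rfl

/-! ### Stanley-Reisner ideals and graded Betti numbers -/

/-- The Stanley-Reisner ideal of a matroid `M`, generated by the squarefree monomials
`∏_{e ∈ σ} X_e` of the dependent sets `σ`. -/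
def stanleyReisnerIdeal (K : Type*) [Field K] {E : Type*} (M : Matroid E) :
    Ideal (MvPolynomial E K) :=
  Ideal.span {p | ∃ σ : Finset E, M.Dep (σ : Set E) ∧ p = ∏ e ∈ σ, MvPolynomial.X e}

/-- A minimal graded free resolution of `R/I`, where `R = K[X_e : e ∈ E]` is graded by a monoid
`A` through `deg X_e = w e`. The `i`-th module is `F_i = ⨁_j R(-deg i j)`, with basis indexed by
`Fin (rank i)`; the maps are given by matrices whose entries are homogeneous of the degrees that
make them maps of degree `0`, and minimality means that no entry has a constant term. -/
structure MinimalGradedFreeResolution {K E A : Type*} [Field K] [AddCommMonoid A] (w : E → A)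
    (I : Ideal (MvPolynomial E K)) where
  /-- the rank of `F_i` -/
  rank : ℕ → ℕ
  /-- the degrees of the basis elements of `F_i` -/
  deg : (i : ℕ) → Fin (rank i) → A
  /-- the images of the basis elements of `F_0` under the augmentation `F_0 → R/I` -/
  aug : Fin (rank 0) → MvPolynomial E K ⧸ I
  /-- the matrix of the differential `F_{i+1} → F_i` -/
  d : (i : ℕ) → Matrix (Fin (rank i)) (Fin (rank (i + 1))) (MvPolynomial E K)
  aug_homogeneous : ∀ a, ∃ p : MvPolynomial E K,
    MvPolynomial.IsWeightedHomogeneous w p (deg 0 a) ∧ Ideal.Quotient.mk I p = aug a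
  d_homogeneous : ∀ i a b, d i a b ≠ 0 →
    ∃ s : A, deg i a + s = deg (i + 1) b ∧ MvPolynomial.IsWeightedHomogeneous w (d i a b) s
  aug_surjective : ∀ y : MvPolynomial E K ⧸ I,
    ∃ x : Fin (rank 0) → MvPolynomial E K, ∑ a, x a • aug a = y
  exact_zero : ∀ x : Fin (rank 0) → MvPolynomial E K,
    ∑ a, x a • aug a = 0 ↔ ∃ y, d 0 *ᵥ y = x
  exact_succ : ∀ i, ∀ x : Fin (rank (i + 1)) → MvPolynomial E K,
    d i *ᵥ x = 0 ↔ ∃ y, d (i + 1) *ᵥ y = x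
  minimal : ∀ i a b, MvPolynomial.constantCoeff (d i a b) = 0

/-- The multiplicity of `R(-g)` in the `i`-th module of the resolution. -/
def MinimalGradedFreeResolution.multiplicity {K E A : Type*} [Field K] [AddCommMonoid A]
    {w : E → A} {I : Ideal (MvPolynomial E K)} (Φ : MinimalGradedFreeResolution w I)
    (i : ℕ) (g : A) : ℕ :=
  Nat.card {a : Fin (Φ.rank i) // Φ.deg i a = g}

/-- The graded Betti number `β_{i,g}` of `R/I` is (well defined and) equal to `b`: minimal graded
free resolutions of `R/I` exist, and `R(-g)` occurs exactly `b` times in homological degree `i`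
of each of them. -/
def HasGradedBettiNumber {K E A : Type*} [Field K] [AddCommMonoid A] (w : E → A)
    (I : Ideal (MvPolynomial E K)) (i : ℕ) (g : A) (b : ℕ) : Prop :=
  Nonempty (MinimalGradedFreeResolution w I) ∧
    ∀ Φ : MinimalGradedFreeResolution w I, Φ.multiplicity i g = b

/-- The weights of the `ℕ^E`-grading (fine grading) of `K[X_e : e ∈ E]`: `deg X_e` is the `e`-th
unit vector. -/
def fineWeight (E : Type*) (e : E) : E →₀ ℕ := Finsupp.single e 1

/-- The weights of the standard `ℕ`-grading of `K[X_e : e ∈ E]`: `deg X_e = 1`. -/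
def standardWeight (E : Type*) (_ : E) : ℕ := 1

/-- The squarefree degree in `ℕ^E` that belongs to a subset `σ` of `E`. -/
def subsetDegree {E : Type*} (σ : Finset E) : E →₀ ℕ := ∑ e ∈ σ, Finsupp.single e 1

/-- The `ℕ^E`-graded Betti number `β_{i,σ}` of the matroid `M`, over the field `K`, equals `b`. -/
def HasFineBettiNumber (K : Type*) [Field K] {E : Type*} (M : Matroid E) (i : ℕ) (σ : Finset E)
    (b : ℕ) : Prop :=
  HasGradedBettiNumber (fineWeight E) (stanleyReisnerIdeal K M) i (subsetDegree σ) b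

/-- The `ℕ`-graded Betti number `β_{i,j}` of the matroid `M`, over the field `K`, equals `b`. -/
def HasStandardBettiNumber (K : Type*) [Field K] {E : Type*} (M : Matroid E) (i j : ℕ)
    (b : ℕ) : Prop :=
  HasGradedBettiNumber (standardWeight E) (stanleyReisnerIdeal K M) i j b

end

/-! The second Betti numbers of `R/I` are the dimensions of the graded pieces of `Tor₂(R/I, K) =
Tor₁(I, K)`, that is, of the first homology of the Koszul complex with coefficients in `I`. For a
squarefree monomial ideal this vanishes outside the squarefree degrees. In degree `σ` it is the
reduced zeroth homology of a graph: the vertices are the `e ∈ σ` whose removal leaves a dependent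
set, the edges are the pairs whose joint removal does. Its dimension is the number of components
minus one, or zero if there are no vertices. `MinimalGradedFreeResolution.multiplicity_two` proves
this for every minimal resolution and every weight grading in which only the monomial `1` has degree
zero, so one formula serves both gradings; `nonempty_minimalGradedFreeResolution` supplies
existence.

Code words are evaluations of conics, hence a set is dependent exactly when some nonzero conic
passes through all points outside it (`columnMatroid_dep_iff`). With `X` the complement of `σ`, the
vertices are the points of `σ` on a conic through `X`, and the edges join two points lying together
on such a conic.

If `X` is a line `ℓ` with a point `e₀` off it, every conic through `X` is `ℓ` times a line through
`e₀`. The components are then the `q + 1` lines through `e₀`, and the dimension is `q`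
(`IsPointEnumeration.finrank_koszulHomology_add_one`). If `X` has `q + 2` points but not this shape,
then at most one conic up to scalars contains it: a pencil with five or more base points has all of
them on a line, with at most one exception (`IsPointEnumeration.exists_line_of_pencil`). Any two
vertices are then adjacent and the homology is zero. So the number in degree `q² - 1` is `q` times
the number `(q² + q + 1) q²` of pairs of a line and a point off it. -/

noncomputable section

/-! ### Finely graded submodules of free modules and their minimal covers -/

section FineGrading

open MvPolynomial

variable {K E : Type*} [Field K]

/-- The component of degree `g` in the fine grading of the free module with basis degrees `δ`. -/
def fineComponent {r : ℕ} (δ : Fin r → E →₀ ℕ) (g : E →₀ ℕ) (x : Fin r → MvPolynomial E K) :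
    Fin r → MvPolynomial E K :=
  fun a => open Classical in if δ a ≤ g then monomial (g - δ a) (coeff (g - δ a) (x a)) else 0

theorem coeff_fineComponent {r : ℕ} (δ : Fin r → E →₀ ℕ) (g : E →₀ ℕ)
    (x : Fin r → MvPolynomial E K) (a : Fin r) (m : E →₀ ℕ) :
    coeff m (fineComponent δ g x a) = open Classical in if δ a + m = g then coeff m (x a) else 0 := by
  classical
  unfold fineComponent
  by_cases h : δ a + m = g
  · have hle : δ a ≤ g := h ▸ le_self_add
    have hm : g - δ a = m := by rw [← h, add_tsub_cancel_left]
    simp [h, hle, hm]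
  · rw [if_neg h]
    split_ifs with hle
    · rw [coeff_monomial, if_neg]
      rintro rfl
      exact h (add_tsub_cancel_of_le hle)
    · simp

/-- Homogeneous elements of degree `g` of the free module with basis degrees `δ`. -/
def IsFineHomogeneous {r : ℕ} (δ : Fin r → E →₀ ℕ) (g : E →₀ ℕ)
    (x : Fin r → MvPolynomial E K) : Prop :=
  ∀ a m, coeff m (x a) ≠ 0 → δ a + m = g

theorem isFineHomogeneous_fineComponent {r : ℕ} (δ : Fin r → E →₀ ℕ) (g : E →₀ ℕ)
    (x : Fin r → MvPolynomial E K) : IsFineHomogeneous δ g (fineComponent δ g x) := by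
  intro a m h
  rw [coeff_fineComponent] at h
  by_contra hne
  exact h (if_neg hne)

theorem sum_fineComponent {r : ℕ} (δ : Fin r → E →₀ ℕ) (x : Fin r → MvPolynomial E K) :
    ∃ S : Finset (E →₀ ℕ), x = ∑ g ∈ S, fineComponent δ g x := by
  classical
  refine ⟨Finset.univ.biUnion fun a => (x a).support.image fun m => δ a + m, ?_⟩
  funext a
  ext m
  rw [Finset.sum_apply, coeff_sum]
  simp_rw [coeff_fineComponent]
  rw [Finset.sum_ite_eq]
  split_ifs with h
  · rfl
  · by_contra hne
    refine h (Finset.mem_biUnion.2 ⟨a, Finset.mem_univ a, Finset.mem_image.2 ⟨m, ?_, rfl⟩⟩)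
    exact mem_support_iff.2 hne

/-- A nonzero entry of a homogeneous matrix shifts degrees exactly by the difference of the basis
degrees. This makes kernels of such matrices graded again, so syzygies can be iterated. -/
theorem fineComponent_mulVec {r s : ℕ} {δ : Fin r → E →₀ ℕ} {δ' : Fin s → E →₀ ℕ}
    {d : Matrix (Fin r) (Fin s) (MvPolynomial E K)}
    (hd : ∀ b, IsFineHomogeneous δ (δ' b) (d.col b)) (g : E →₀ ℕ)
    (x : Fin s → MvPolynomial E K) :
    d *ᵥ fineComponent δ' g x = fineComponent δ g (d *ᵥ x) := by
  classical
  funext a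
  ext m
  rw [coeff_fineComponent]
  simp only [Matrix.mulVec, dotProduct, coeff_sum, coeff_mul]
  have key : ∀ b, ∀ p ∈ Finset.HasAntidiagonal.antidiagonal m, coeff p.1 (d a b) *
      coeff p.2 (fineComponent δ' g x b) =
      if δ a + m = g then coeff p.1 (d a b) * coeff p.2 (x b) else 0 := by
    intro b p hp
    rw [coeff_fineComponent]
    by_cases h0 : coeff p.1 (d a b) = 0
    · simp [h0]
    · have h1 : δ a + p.1 = δ' b := hd b a p.1 h0
      have h2 : p.1 + p.2 = m := Finset.HasAntidiagonal.mem_antidiagonal.1 hp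
      rw [← h1, ← h2, add_assoc]
      split_ifs <;> simp
  rw [Finset.sum_congr rfl fun b _ => Finset.sum_congr rfl (key b)]
  split_ifs <;> simp

variable (K E) in
/-- A finely graded submodule of a finitely generated free module. -/
structure FineSubmodule where
  /-- the rank of the free module -/
  rank : ℕ
  /-- the degrees of the basis -/
  deg : Fin rank → E →₀ ℕ
  /-- the submodule -/
  carrier : Submodule (MvPolynomial E K) (Fin rank → MvPolynomial E K)
  graded : ∀ x ∈ carrier, ∀ g, fineComponent deg g x ∈ carrier

/-- `Z` is generated by `s` homogeneous elements. -/
def FineSubmodule.GeneratedBy (Z : FineSubmodule K E) (s : ℕ) : Prop :=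
  ∃ (δ : Fin s → E →₀ ℕ) (d : Matrix (Fin Z.rank) (Fin s) (MvPolynomial E K)),
    (∀ b, IsFineHomogeneous Z.deg (δ b) (d.col b)) ∧
      Submodule.span (MvPolynomial E K) (Set.range d.col) = Z.carrier

/-- The polynomial ring is Noetherian, and finitely many generators may be replaced by their
finitely many homogeneous components. -/
theorem FineSubmodule.exists_generatedBy [Finite E] (Z : FineSubmodule K E) :
    ∃ s, Z.GeneratedBy s := by
  classical
  obtain ⟨T, hT⟩ := IsNoetherian.noetherian Z.carrier
  choose S hS using fun x : Fin Z.rank → MvPolynomial E K => sum_fineComponent Z.deg x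
  let U : Finset ((E →₀ ℕ) × (Fin Z.rank → MvPolynomial E K)) :=
    T.biUnion fun x => (S x).image fun g => (g, fineComponent Z.deg g x)
  have hU : ∀ u ∈ U, ∃ x ∈ T, u.2 = fineComponent Z.deg u.1 x := by
    intro u hu
    obtain ⟨x, hx, hu⟩ := Finset.mem_biUnion.1 hu
    obtain ⟨g, -, rfl⟩ := Finset.mem_image.1 hu
    exact ⟨x, hx, rfl⟩
  refine ⟨U.card, fun b => (U.equivFin.symm b).1.1,
    fun a b => (U.equivFin.symm b).1.2 a, fun b => ?_, le_antisymm ?_ ?_⟩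
  · obtain ⟨x, -, h⟩ := hU _ (U.equivFin.symm b).2
    have := isFineHomogeneous_fineComponent Z.deg (U.equivFin.symm b).1.1 x
    rwa [← h] at this
  · rw [Submodule.span_le]
    rintro _ ⟨b, rfl⟩
    obtain ⟨x, hx, h⟩ := hU _ (U.equivFin.symm b).2
    have := Z.graded x (hT ▸ Submodule.subset_span hx) (U.equivFin.symm b).1.1
    rwa [← h] at this
  · rw [← hT, Submodule.span_le]
    intro x hx
    rw [SetLike.mem_coe, hS x]
    refine Submodule.sum_mem _ fun g hg => Submodule.subset_span ?_
    have hmem : (g, fineComponent Z.deg g x) ∈ U :=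
      Finset.mem_biUnion.2 ⟨x, hx, Finset.mem_image.2 ⟨g, hg, rfl⟩⟩
    refine ⟨U.equivFin ⟨_, hmem⟩, ?_⟩
    funext a
    simp [Matrix.col, Matrix.transpose]

theorem mulVec_eq_sum_col {r s : ℕ} {R : Type*} [CommRing R] (d : Matrix (Fin r) (Fin s) R)
    (y : Fin s → R) : d *ᵥ y = ∑ b, y b • d.col b := by
  rw [Matrix.mulVec_eq_sum]
  simp [Matrix.col, Matrix.transpose]

/-- Take the least possible number of homogeneous generators: a relation with a nonzero constant
term would make one of them superfluous. -/
theorem FineSubmodule.exists_minimal_cover [Finite E] (Z : FineSubmodule K E) :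
    ∃ (s : ℕ) (δ : Fin s → E →₀ ℕ) (d : Matrix (Fin Z.rank) (Fin s) (MvPolynomial E K)),
      (∀ b, IsFineHomogeneous Z.deg (δ b) (d.col b)) ∧
      (∀ x, x ∈ Z.carrier ↔ ∃ y, d *ᵥ y = x) ∧
      ∀ y, d *ᵥ y = 0 → ∀ b, constantCoeff (y b) = 0 := by
  classical
  have hex := Z.exists_generatedBy
  obtain ⟨δ, d, hd, hspan⟩ := Nat.find_spec hex
  refine ⟨Nat.find hex, δ, d, hd, fun x => ?_, fun y hy b => ?_⟩
  · rw [← hspan, Submodule.mem_span_range_iff_exists_fun]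
    simp_rw [mulVec_eq_sum_col]
  · by_contra hb
    have key : ∀ s, s < Nat.find hex → ¬ Z.GeneratedBy s := fun s hs => Nat.find_min hex hs
    generalize Nat.find hex = s at *
    obtain _ | s := s
    · exact b.elim0
    refine key s (Nat.lt_succ_self s) ⟨δ ∘ b.succAbove, fun a c => d a (b.succAbove c),
      fun c => hd (b.succAbove c), le_antisymm ?_ ?_⟩
    · rw [← hspan]
      refine Submodule.span_mono ?_
      rintro _ ⟨c, rfl⟩
      exact ⟨b.succAbove c, rfl⟩
    · set N := Submodule.span (MvPolynomial E K)
        (Set.range (Matrix.col fun a c => d a (b.succAbove c))) with hN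
      have hmem : ∀ c, d.col (b.succAbove c) ∈ N := fun c => Submodule.subset_span ⟨c, rfl⟩
      rw [← hspan, Submodule.span_le]
      rintro _ ⟨c, rfl⟩
      obtain rfl | ⟨c, rfl⟩ := b.eq_self_or_eq_succAbove c
      -- The component of the relation in the degree of generator `c` has a nonzero constant as its
      -- `c`-th entry, so that generator is a combination of the others.
      · set y' := fineComponent δ (δ c) y
        have h0 : d *ᵥ y' = 0 := by
          rw [fineComponent_mulVec hd, hy]
          funext a
          simp [fineComponent]
        have hyc : y' c = C (constantCoeff (y c)) := by
          simp [y', fineComponent, constantCoeff_eq]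
        rw [mulVec_eq_sum_col, Fin.sum_univ_succAbove _ c, hyc] at h0
        have h1 : (C (constantCoeff (y c)) : MvPolynomial E K) • d.col c ∈ N := by
          rw [eq_neg_of_add_eq_zero_left h0]
          exact N.neg_mem (N.sum_mem fun i _ => N.smul_mem _ (hmem i))
        have h2 := N.smul_mem (C (constantCoeff (y c))⁻¹ : MvPolynomial E K) h1
        rwa [smul_smul, ← C_mul, inv_mul_cancel₀ hb, C_1, one_smul] at h2
      · exact hmem c

/-- The rank of a minimal cover of a finely graded submodule. -/
def FineSubmodule.coverRank [Finite E] (Z : FineSubmodule K E) : ℕ :=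
  Z.exists_minimal_cover.choose

/-- The basis degrees of a minimal cover of a finely graded submodule. -/
def FineSubmodule.coverDeg [Finite E] (Z : FineSubmodule K E) : Fin Z.coverRank → E →₀ ℕ :=
  Z.exists_minimal_cover.choose_spec.choose

/-- The matrix of a minimal cover of a finely graded submodule. -/
def FineSubmodule.cover [Finite E] (Z : FineSubmodule K E) :
    Matrix (Fin Z.rank) (Fin Z.coverRank) (MvPolynomial E K) :=
  Z.exists_minimal_cover.choose_spec.choose_spec.choose

theorem FineSubmodule.cover_homogeneous [Finite E] (Z : FineSubmodule K E) (b : Fin Z.coverRank) :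
    IsFineHomogeneous Z.deg (Z.coverDeg b) (Z.cover.col b) :=
  Z.exists_minimal_cover.choose_spec.choose_spec.choose_spec.1 b

theorem FineSubmodule.mem_iff_cover [Finite E] (Z : FineSubmodule K E)
    (x : Fin Z.rank → MvPolynomial E K) : x ∈ Z.carrier ↔ ∃ y, Z.cover *ᵥ y = x :=
  Z.exists_minimal_cover.choose_spec.choose_spec.choose_spec.2.1 x

theorem FineSubmodule.cover_minimal [Finite E] (Z : FineSubmodule K E)
    (y : Fin Z.coverRank → MvPolynomial E K) (hy : Z.cover *ᵥ y = 0) (b : Fin Z.coverRank) :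
    constantCoeff (y b) = 0 :=
  Z.exists_minimal_cover.choose_spec.choose_spec.choose_spec.2.2 y hy b

/-- The syzygies of a minimal cover of a finely graded submodule. -/
def FineSubmodule.syzygies [Finite E] (Z : FineSubmodule K E) : FineSubmodule K E where
  rank := Z.coverRank
  deg := Z.coverDeg
  carrier := LinearMap.ker Z.cover.mulVecLin
  graded x hx g := by
    rw [LinearMap.mem_ker, Matrix.mulVecLin_apply] at hx ⊢
    rw [fineComponent_mulVec Z.cover_homogeneous, hx]
    funext a
    simp [fineComponent]

/-- The iterated syzygies of a finely graded submodule. -/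
def FineSubmodule.iterate [Finite E] (Z : FineSubmodule K E) : ℕ → FineSubmodule K E
  | 0 => Z
  | i + 1 => (Z.iterate i).syzygies

theorem FineSubmodule.iterate_le [Finite E] (Z : FineSubmodule K E)
    (hZ : ∀ x ∈ Z.carrier, ∀ a, constantCoeff (x a) = 0) (i : ℕ) :
    ∀ x ∈ (Z.iterate i).carrier, ∀ a, constantCoeff (x a) = 0 := by
  cases i with
  | zero => exact hZ
  | succ i => exact fun x hx a => (Z.iterate i).cover_minimal x hx a

theorem smul_one_eq_quotient_mk {R : Type*} [CommRing R] (I : Ideal R) (p : R) :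
    p • (1 : R ⧸ I) = Ideal.Quotient.mk I p := by
  rw [← Ideal.Quotient.algebraMap_eq, Algebra.algebraMap_eq_smul_one]

/-- Iterated minimal covers of `I`, viewed inside a free module of rank one, resolve in the fine
grading; pushing the degrees forward along `w` gives every other grading. -/
theorem nonempty_minimalGradedFreeResolution [Finite E] {A : Type*} [AddCommMonoid A] (w : E → A)
    {I : Ideal (MvPolynomial E K)} (hmon : ∀ f ∈ I, ∀ m, monomial m (coeff m f) ∈ I)
    (hI : ∀ f ∈ I, constantCoeff f = 0) : Nonempty (MinimalGradedFreeResolution w I) := by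
  classical
  let Z : FineSubmodule K E :=
    { rank := 1
      deg := fun _ => 0
      carrier := Submodule.comap
        (LinearMap.proj (R := MvPolynomial E K) (φ := fun _ : Fin 1 => MvPolynomial E K) 0) I
      graded := fun x hx g => by
        simpa [fineComponent] using hmon _ hx g }
  have hZ := Z.iterate_le fun x hx a => by
    obtain rfl : a = (0 : Fin 1) := Subsingleton.elim (α := Fin 1) a 0
    exact hI _ hx
  refine ⟨{
    rank := fun i => (Z.iterate i).rank
    deg := fun i a => Finsupp.weight w ((Z.iterate i).deg a)
    aug := fun _ => 1
    d := fun i => (Z.iterate i).cover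
    aug_homogeneous := fun a => ⟨1, ?_, map_one _⟩
    d_homogeneous := fun i a b hne => ?_
    aug_surjective := fun y => ?_
    exact_zero := fun x => ?_
    exact_succ := fun i x => (Z.iterate i).syzygies.mem_iff_cover x
    minimal := fun i a b => ?_ }⟩
  · have : Finsupp.weight w ((Z.iterate 0).deg a) = 0 := map_zero (Finsupp.weight w)
    rw [this]
    exact isWeightedHomogeneous_one K w
  · obtain ⟨m, hm⟩ := exists_coeff_ne_zero hne
    have h := (Z.iterate i).cover_homogeneous b
    refine ⟨Finsupp.weight w m, ?_, fun m' hm' => ?_⟩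
    · rw [← map_add, h a m hm]
      rfl
    · rw [add_left_cancel ((h a m' hm').trans (h a m hm).symm)]
  · obtain ⟨p, rfl⟩ := Ideal.Quotient.mk_surjective y
    refine ⟨fun _ => p, ?_⟩
    change ∑ a : Fin 1, p • (1 : MvPolynomial E K ⧸ I) = _
    rw [Fin.sum_univ_one, smul_one_eq_quotient_mk]
  · refine Iff.trans ?_ (Z.mem_iff_cover x)
    change ∑ a : Fin 1, x a • (1 : MvPolynomial E K ⧸ I) = 0 ↔ x (0 : Fin 1) ∈ I
    rw [Fin.sum_univ_one, ← Ideal.Quotient.eq_zero_iff_mem, smul_one_eq_quotient_mk]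
  · exact hZ i ((Z.iterate i).cover.col b)
      (((Z.iterate i).mem_iff_cover _).2 ⟨_, (Z.iterate i).cover.mulVec_single_one b⟩) a

end FineGrading

/-! ### Second Betti numbers of squarefree monomial ideals through the Koszul complex -/

section KoszulDegree

open MvPolynomial

set_option linter.unusedSectionVars false

variable {K E : Type*} [Field K] [Fintype E] [DecidableEq E]

/-- A vector with coordinate sum zero is the combination of the differences to a base point `e₀`
with its own coordinates as coefficients. -/
theorem mem_of_single_sub_single_mem (N : Submodule K (E → K)) (k : E → K) (hk : ∑ e, k e = 0)
    (e₀ : E) (h : ∀ e, k e ≠ 0 → e ≠ e₀ → Pi.single e 1 - Pi.single e₀ 1 ∈ N) : k ∈ N := by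
  have hsum : k = ∑ e, k e • ((Pi.single e 1 : E → K) - Pi.single e₀ 1) := by
    simp_rw [smul_sub, Finset.sum_sub_distrib, ← Finset.sum_smul, hk, zero_smul, sub_zero]
    funext i
    simp [Finset.sum_apply, Pi.single_apply]
  rw [hsum]
  refine N.sum_mem fun e _ => ?_
  by_cases hz : k e = 0
  · simp [hz]
  · by_cases he : e = e₀
    · simp [he]
    · exact N.smul_mem _ (h e hz he)

/-- The boundaries in fine degree `α` of the Koszul complex, in homological degree `1`, with
coefficients in the monomial ideal spanned by the monomials whose support satisfies `dep`. -/
def koszulBoundary (K : Type*) [Field K] (dep : Finset E → Prop) (α : E →₀ ℕ) :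
    Submodule K (E → K) :=
  Submodule.span K {v | ∃ (e i : E) (γ : E →₀ ℕ), dep γ.support ∧
    γ + Finsupp.single e 1 + Finsupp.single i 1 = α ∧ v = Pi.single e 1 - Pi.single i 1}

/-- The cycles in fine degree `α` of the Koszul complex, in homological degree `1`, with
coefficients in the monomial ideal spanned by the monomials whose support satisfies `dep`. -/
def koszulCycle (K : Type*) [Field K] (dep : Finset E → Prop) (α : E →₀ ℕ) :
    Submodule K (E → K) where
  carrier := {c | ∑ e, c e = 0 ∧
    ∀ e, c e ≠ 0 → ∃ γ : E →₀ ℕ, dep γ.support ∧ γ + Finsupp.single e 1 = α}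
  zero_mem' := by simp
  add_mem' := by
    rintro c c' ⟨h1, h2⟩ ⟨h1', h2'⟩
    refine ⟨by simp [Finset.sum_add_distrib, h1, h1'], fun e he => ?_⟩
    by_cases hc : c e = 0
    · exact h2' e fun hc' => he (by simp [hc, hc'])
    · exact h2 e hc
  smul_mem' := by
    rintro x c ⟨h1, h2⟩
    refine ⟨by simp [← Finset.mul_sum, h1], fun e he => h2 e fun hc => he (by simp [hc])⟩

/-- The first Koszul homology in fine degree `α` of the monomial ideal spanned by the monomials
whose support satisfies `dep`. -/
abbrev KoszulHomology (K : Type*) [Field K] (dep : Finset E → Prop) (α : E →₀ ℕ) : Type _ :=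
  koszulCycle K dep α ⧸ (koszulBoundary K dep α).submoduleOf (koszulCycle K dep α)

/-- The coefficient vector in fine degree `α` of a Koszul `1`-chain. -/
def koszulCoeff (α : E →₀ ℕ) : (E → MvPolynomial E K) →ₗ[K] (E → K) where
  toFun u e := coeff α (X e * u e)
  map_add' u v := by
    funext e
    simp [mul_add]
  map_smul' c u := by
    funext e
    simp

theorem koszulCoeff_apply (α : E →₀ ℕ) (u : E → MvPolynomial E K) (e : E) :
    koszulCoeff α u e = coeff α (X e * u e) := rfl

theorem exists_add_single_of_coeff_X_mul_ne_zero {α : E →₀ ℕ} {e : E} {p : MvPolynomial E K}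
    (h : coeff α (X e * p) ≠ 0) : ∃ γ, γ + Finsupp.single e 1 = α ∧ coeff γ p ≠ 0 := by
  rw [coeff_X_mul'] at h
  split_ifs at h with he
  · refine ⟨α - Finsupp.single e 1, tsub_add_cancel_of_le ?_, h⟩
    rw [Finsupp.single_le_iff]
    exact Nat.one_le_iff_ne_zero.2 (Finsupp.mem_support_iff.1 he)
  · exact absurd rfl h

theorem exists_add_single_add_single {β : E →₀ ℕ} {e e' : E} (hne : e ≠ e') (he : β e ≠ 0)
    (he' : β e' ≠ 0) : ∃ γ, γ + Finsupp.single e 1 + Finsupp.single e' 1 = β := by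
  refine ⟨β - Finsupp.single e 1 - Finsupp.single e' 1, ?_⟩
  ext i
  simp only [Finsupp.add_apply, Finsupp.tsub_apply, Finsupp.single_apply]
  split_ifs with h1 h2 h2
  · exact absurd (h1.trans h2.symm) hne
  · subst h1; omega
  · subst h2; omega
  · omega

/-- The variables form a regular sequence, so a Koszul cycle over the ring is a boundary; multiplied
by a monomial `m` of `I`, it is a boundary with coefficients in `I`. In degree `α` only those `e`
occur that divide `α - m`, and any two of them are joined by a Koszul `2`-chain that is a multiple
of `m`. -/
theorem koszulCoeff_mul_mem_koszulBoundary {dep : Finset E → Prop}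
    (hmono : ∀ σ τ, σ ⊆ τ → dep σ → dep τ) {I : Ideal (MvPolynomial E K)}
    (hI : ∀ f, f ∈ I ↔ ∀ m ∈ f.support, dep m.support) (p : E → MvPolynomial E K)
    (hp : ∑ e, X e * p e = 0) {f : MvPolynomial E K} (hf : f ∈ I) (α : E →₀ ℕ) :
    koszulCoeff α (fun e => p e * f) ∈ koszulBoundary K dep α := by
  have hf' := (hI f).1 hf
  have hsum : (fun e => p e * f) = ∑ m ∈ f.support, fun e => monomial m (coeff m f) * p e := by
    funext e
    rw [Finset.sum_apply, ← Finset.sum_mul, ← f.as_sum, mul_comm]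
  rw [hsum, map_sum]
  refine Submodule.sum_mem _ fun m hm => ?_
  have hc : ∀ e, koszulCoeff α (fun e => monomial m (coeff m f) * p e) e =
      if m ≤ α then coeff m f * coeff (α - m) (X e * p e) else 0 := fun e => by
    rw [koszulCoeff_apply, mul_left_comm, coeff_monomial_mul']
  by_cases hle : m ≤ α
  swap
  · convert Submodule.zero_mem _
    funext e
    rw [hc, if_neg hle]
    rfl
  simp only [hle, if_true] at hc
  have hex : ∀ e, koszulCoeff α (fun e => monomial m (coeff m f) * p e) e ≠ 0 →
      (α - m) e ≠ 0 := by
    intro e he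
    rw [hc] at he
    obtain ⟨γ, hγ, -⟩ := exists_add_single_of_coeff_X_mul_ne_zero (right_ne_zero_of_mul he)
    rw [← hγ]
    simp
  by_cases h0 : ∃ e₀, koszulCoeff α (fun e => monomial m (coeff m f) * p e) e₀ ≠ 0
  · obtain ⟨e₀, he₀⟩ := h0
    refine mem_of_single_sub_single_mem _ _ ?_ e₀ fun e he hne => ?_
    · simp_rw [hc]
      rw [← Finset.mul_sum, ← coeff_sum, hp, coeff_zero, mul_zero]
    · obtain ⟨γ, hγ⟩ := exists_add_single_add_single hne (hex e he) (hex e₀ he₀)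
      refine Submodule.subset_span ⟨e, e₀, m + γ, hmono _ _ ?_ (hf' m hm), ?_, rfl⟩
      · intro i
        simp only [Finsupp.mem_support_iff, Finsupp.add_apply]
        omega
      · rw [add_assoc m, add_assoc m, hγ, add_tsub_cancel_of_le hle]
  · push Not at h0
    convert Submodule.zero_mem _
    funext e
    exact h0 e

/-- Lowering an exponent that is at least two does not change the support, hence not membership in
the ideal. So every vertex is joined to `e₀`, and the graph is connected. -/
theorem koszulCycle_le_koszulBoundary_of_two_le {dep : Finset E → Prop} {α : E →₀ ℕ} {e₀ : E}
    (h : 2 ≤ α e₀) : koszulCycle K dep α ≤ koszulBoundary K dep α := by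
  rintro c ⟨hc, hc'⟩
  refine mem_of_single_sub_single_mem _ _ hc e₀ fun e he hne => ?_
  obtain ⟨γ, hγ, rfl⟩ := hc' e he
  have h2 : 2 ≤ γ e₀ := by
    rwa [Finsupp.add_apply, Finsupp.single_eq_of_ne (Ne.symm hne), add_zero] at h
  refine Submodule.subset_span ⟨e, e₀, γ - Finsupp.single e₀ 1, ?_, ?_, rfl⟩
  · convert hγ using 1
    ext i
    simp only [Finsupp.mem_support_iff, Finsupp.tsub_apply, Finsupp.single_apply]
    split_ifs with hi
    · subst hi; omega
    · simp
  · rw [add_right_comm, tsub_add_cancel_of_le]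
    rw [Finsupp.single_le_iff]
    omega

theorem koszulCoeff_mem_koszulCycle {dep : Finset E → Prop} {I : Ideal (MvPolynomial E K)}
    (hI : ∀ f, f ∈ I ↔ ∀ m ∈ f.support, dep m.support) {u : E → MvPolynomial E K}
    (hu : ∀ e, u e ∈ I) (hsum : ∑ e, X e * u e = 0) (α : E →₀ ℕ) :
    koszulCoeff α u ∈ koszulCycle K dep α := by
  refine ⟨?_, fun e he => ?_⟩
  · simp_rw [koszulCoeff_apply]
    rw [← coeff_sum, hsum, coeff_zero]
  · obtain ⟨γ, hγ, hne⟩ := exists_add_single_of_coeff_X_mul_ne_zero he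
    exact ⟨γ, (hI _).1 (hu e) γ (mem_support_iff.2 hne), hγ⟩

/-- The homogeneous Koszul `1`-chain of fine degree `α` with a given coefficient vector. -/
def koszulMonomial (α : E →₀ ℕ) : (E → K) →ₗ[K] (E → MvPolynomial E K) where
  toFun c e := if Finsupp.single e 1 ≤ α then monomial (α - Finsupp.single e 1) (c e) else 0
  map_add' c c' := by
    funext e
    simp only [Pi.add_apply]
    split_ifs <;> simp
  map_smul' x c := by
    funext e
    simp only [Pi.smul_apply, RingHom.id_apply]
    split_ifs <;> simp [smul_monomial]

theorem koszulMonomial_apply (α : E →₀ ℕ) (c : E → K) (e : E) : koszulMonomial α c e =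
    if Finsupp.single e 1 ≤ α then monomial (α - Finsupp.single e 1) (c e) else 0 := rfl

theorem coeff_koszulMonomial (α : E →₀ ℕ) (c : E → K) (e : E) (m : E →₀ ℕ) :
    coeff m (koszulMonomial α c e) = if Finsupp.single e 1 + m = α then c e else 0 := by
  rw [koszulMonomial_apply]
  split_ifs with h1 h2 h2
  · rw [coeff_monomial, if_pos]
    rw [← h2, add_tsub_cancel_left]
  · rw [coeff_monomial, if_neg]
    rintro rfl
    exact h2 (add_tsub_cancel_of_le h1)
  · exact absurd (h2 ▸ le_self_add) h1
  · simp

theorem eq_sum_koszulMonomial (u : E → MvPolynomial E K) :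
    ∃ S : Finset (E →₀ ℕ), u = ∑ α ∈ S, koszulMonomial α (koszulCoeff α u) := by
  refine ⟨Finset.univ.biUnion fun e => (u e).support.image fun m => Finsupp.single e 1 + m, ?_⟩
  funext e
  ext m
  rw [Finset.sum_apply, coeff_sum]
  simp_rw [coeff_koszulMonomial, koszulCoeff_apply]
  rw [Finset.sum_ite_eq, coeff_X_mul]
  split_ifs with h
  · rfl
  · by_contra hne
    refine h (Finset.mem_biUnion.2 ⟨e, Finset.mem_univ e, Finset.mem_image.2 ⟨m, ?_, rfl⟩⟩)
    exact mem_support_iff.2 hne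

theorem koszulCoeff_koszulMonomial_self {dep : Finset E → Prop} {α : E →₀ ℕ} {c : E → K}
    (hc : c ∈ koszulCycle K dep α) : koszulCoeff α (koszulMonomial α c) = c := by
  funext e
  rw [koszulCoeff_apply]
  by_cases h : c e = 0
  · rw [h, koszulMonomial_apply, h]
    simp
  · obtain ⟨γ, -, rfl⟩ := hc.2 e h
    rw [add_comm γ, coeff_X_mul, coeff_koszulMonomial, if_pos rfl]

theorem koszulCoeff_koszulMonomial_of_ne {α β : E →₀ ℕ} (hne : β ≠ α) (c : E → K) :
    koszulCoeff α (koszulMonomial β c) = 0 := by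
  funext e
  by_contra h
  obtain ⟨γ, hγ, h'⟩ := exists_add_single_of_coeff_X_mul_ne_zero h
  rw [coeff_koszulMonomial] at h'
  split_ifs at h' with h2
  · exact hne (by rw [← h2, ← hγ, add_comm])
  · exact h' rfl

theorem koszulMonomial_mem {dep : Finset E → Prop} {I : Ideal (MvPolynomial E K)}
    (hI : ∀ f, f ∈ I ↔ ∀ m ∈ f.support, dep m.support) {α : E →₀ ℕ} {c : E → K}
    (hc : c ∈ koszulCycle K dep α) (e : E) : koszulMonomial α c e ∈ I := by
  rw [hI]
  intro m hm
  rw [mem_support_iff, coeff_koszulMonomial] at hm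
  split_ifs at hm with h
  · obtain ⟨γ, hγ, h'⟩ := hc.2 e hm
    rw [← h, add_comm] at h'
    rwa [← add_left_cancel h']
  · exact absurd rfl hm

theorem sum_X_mul_koszulMonomial {dep : Finset E → Prop} {α : E →₀ ℕ} {c : E → K}
    (hc : c ∈ koszulCycle K dep α) : ∑ e, X e * koszulMonomial α c e = 0 := by
  have h : ∀ e, X e * koszulMonomial α c e = monomial α (c e) := by
    intro e
    by_cases hz : c e = 0
    · rw [koszulMonomial_apply, hz]
      simp
    · obtain ⟨γ, -, rfl⟩ := hc.2 e hz
      rw [koszulMonomial_apply, if_pos le_add_self, add_tsub_cancel_right, X, monomial_mul,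
        one_mul, add_comm]
  simp_rw [h]
  rw [← map_sum, hc.1, map_zero]

theorem koszulMonomial_single {α : E →₀ ℕ} {e : E} {γ : E →₀ ℕ}
    (h : γ + Finsupp.single e 1 = α) :
    koszulMonomial α (Pi.single e (1 : K)) = Pi.single e (monomial γ 1) := by
  funext i
  rw [koszulMonomial_apply]
  by_cases hi : i = e
  · subst hi
    rw [if_pos (h ▸ le_add_self), Pi.single_eq_same, Pi.single_eq_same, ← h,
      add_tsub_cancel_right]
  · simp [hi]

/-- Sums of multiples of the variables, sorted by monomials. -/
theorem exists_sum_X_mul (p : MvPolynomial E K) (hp : constantCoeff p = 0) :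
    ∃ u : E → MvPolynomial E K, ∑ e, X e * u e = p ∧
      ∀ e m, coeff m (X e * u e) ≠ 0 → coeff m p ≠ 0 := by
  have hne : ∀ m ∈ p.support, ∃ e, m e ≠ 0 := by
    intro m hm
    by_contra! h
    have : m = 0 := Finsupp.ext h
    rw [mem_support_iff, this] at hm
    exact hm hp
  by_cases hE : Nonempty E
  swap
  · have hz : p = 0 := by
      by_contra h
      obtain ⟨m, hm⟩ := exists_coeff_ne_zero h
      exact hE ⟨(hne m (mem_support_iff.2 hm)).choose⟩
    exact ⟨0, by simp [hz], by simp⟩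
  have hne' : ∀ m, ∃ e, m ∈ p.support → m e ≠ 0 := by
    intro m
    by_cases hm : m ∈ p.support
    · obtain ⟨e, he⟩ := hne m hm
      exact ⟨e, fun _ => he⟩
    · exact ⟨Classical.arbitrary E, fun h => absurd h hm⟩
  choose ε hε using hne'
  have hX : ∀ e, X e * ∑ m ∈ p.support with ε m = e,
      monomial (m - Finsupp.single e 1) (coeff m p) =
      ∑ m ∈ p.support with ε m = e, monomial m (coeff m p) := by
    intro e
    rw [Finset.mul_sum]
    refine Finset.sum_congr rfl fun m hm => ?_
    obtain ⟨hm', rfl⟩ := Finset.mem_filter.1 hm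
    rw [X, monomial_mul, one_mul, add_tsub_cancel_of_le]
    rw [Finsupp.single_le_iff]
    exact Nat.one_le_iff_ne_zero.2 (hε m hm')
  refine ⟨fun e => ∑ m ∈ p.support with ε m = e,
    monomial (m - Finsupp.single e 1) (coeff m p), ?_, fun e m h => ?_⟩
  · simp_rw [hX]
    rw [Finset.sum_fiberwise, ← p.as_sum]
  · rw [hX, coeff_sum] at h
    obtain ⟨m', -, h'⟩ := Finset.exists_ne_zero_of_sum_ne_zero h
    rw [coeff_monomial] at h'
    split_ifs at h' with hm
    · rwa [← hm]
    · exact absurd rfl h'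

variable {r : ℕ} (φ : (Fin r → MvPolynomial E K) →ₗ[MvPolynomial E K] MvPolynomial E K)

/-- By linearity `φ (t e)` is a sum of products of the coordinates of `t e`, each a Koszul cycle
over the ring, with the elements `φ (Pi.single a 1)` of `I`. Thus the homology class will not depend
on the choice of lifts. -/
theorem koszulCoeff_comp_mem_koszulBoundary {dep : Finset E → Prop}
    (hmono : ∀ σ τ, σ ⊆ τ → dep σ → dep τ) {I : Ideal (MvPolynomial E K)}
    (hI : ∀ f, f ∈ I ↔ ∀ m ∈ f.support, dep m.support) (hφ : ∀ t, φ t ∈ I)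
    (t : E → Fin r → MvPolynomial E K) (ht : ∑ e, (X e : MvPolynomial E K) • t e = 0)
    (α : E →₀ ℕ) : koszulCoeff α (fun e => φ (t e)) ∈ koszulBoundary K dep α := by
  have hsum : (fun e => φ (t e)) =
      ∑ a, fun e => t e a * φ (Pi.single a 1) := by
    funext e
    rw [Finset.sum_apply]
    conv_lhs => rw [LinearMap.pi_apply_eq_sum_univ φ (t e)]
    refine Finset.sum_congr rfl fun a _ => ?_
    rw [smul_eq_mul]
    congr 2
    funext i
    simp [Pi.single_apply, eq_comm]
  rw [hsum, map_sum]
  refine Submodule.sum_mem _ fun a _ =>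
    koszulCoeff_mul_mem_koszulBoundary hmono hI _ ?_ (hφ _) α
  have := congrFun ht a
  simpa [Finset.sum_apply] using this

/-- It suffices to lift the boundary of one `2`-chain on `e`, `e'` with coefficient `X^γ` in `I`:
lift `X^γ` to `s` and take `X_{e'} s` at `e` and `-X_e s` at `e'`. -/
theorem exists_lift_of_koszulBoundary {dep : Finset E → Prop} {I : Ideal (MvPolynomial E K)}
    (hI : ∀ f, f ∈ I ↔ ∀ m ∈ f.support, dep m.support) (hφ : ∀ f ∈ I, ∃ t, φ t = f)
    (u : E → MvPolynomial E K) (hu : ∀ α, koszulCoeff α u ∈ koszulBoundary K dep α) :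
    ∃ t : E → Fin r → MvPolynomial E K, (∀ e, φ (t e) = u e) ∧
      ∑ e, (X e : MvPolynomial E K) • t e = 0 := by
  let T : Submodule K (E → MvPolynomial E K) :=
    { carrier := {u | ∃ t : E → Fin r → MvPolynomial E K, (∀ e, φ (t e) = u e) ∧
        ∑ e, (X e : MvPolynomial E K) • t e = 0}
      zero_mem' := ⟨0, by simp, by simp⟩
      add_mem' := by
        rintro u u' ⟨t, h1, h2⟩ ⟨t', h1', h2'⟩
        exact ⟨t + t', fun e => by simp [h1, h1'],
          by simp [smul_add, Finset.sum_add_distrib, h2, h2']⟩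
      smul_mem' := by
        rintro c u ⟨t, h1, h2⟩
        refine ⟨fun e => (C c : MvPolynomial E K) • t e, fun e => ?_, ?_⟩
        · rw [map_smul, h1, Pi.smul_apply, smul_eq_C_mul, smul_eq_mul]
        · simp_rw [smul_comm _ (C c : MvPolynomial E K)]
          rw [← Finset.smul_sum, h2, smul_zero] }
  change u ∈ T
  obtain ⟨S, hS⟩ := eq_sum_koszulMonomial u
  rw [hS]
  refine T.sum_mem fun α _ => ?_
  suffices h : koszulBoundary K dep α ≤ T.comap (koszulMonomial α) from h (hu α)
  unfold koszulBoundary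
  rw [Submodule.span_le]
  rintro _ ⟨e, e', γ, hγ, hα, rfl⟩
  rw [SetLike.mem_coe, Submodule.mem_comap, map_sub,
    koszulMonomial_single (γ := γ + Finsupp.single e' 1) (by rw [← hα, add_right_comm]),
    koszulMonomial_single hα]
  obtain ⟨s, hs⟩ := hφ (monomial γ 1) <| by
    rw [hI]
    intro m hm
    rw [mem_support_iff, coeff_monomial] at hm
    split_ifs at hm with h
    · rwa [← h]
    · exact absurd rfl hm
  have hm : ∀ i : E, φ ((X i : MvPolynomial E K) • s) = monomial (γ + Finsupp.single i 1) 1 := by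
    intro i
    rw [map_smul, hs, smul_eq_mul, X, monomial_mul, one_mul, add_comm]
  refine ⟨Pi.single e ((X e' : MvPolynomial E K) • s) -
    Pi.single e' ((X e : MvPolynomial E K) • s), fun i => ?_, ?_⟩
  · rw [Pi.sub_apply, Pi.sub_apply, map_sub, Pi.single_apply, Pi.single_apply, Pi.single_apply,
      Pi.single_apply, apply_ite φ, apply_ite φ, hm, hm, map_zero]
  · simp_rw [Pi.sub_apply, smul_sub, Finset.sum_sub_distrib, Pi.single_apply, smul_ite, smul_zero]
    rw [Finset.sum_ite_eq', Finset.sum_ite_eq', smul_comm]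
    simp

end KoszulDegree

/-! ### Second Betti numbers of an arbitrary minimal resolution as Koszul homology -/

section SecondBetti

open MvPolynomial

set_option linter.unusedSectionVars false

/-- The vectors `τ b` define an isomorphism from `K^B` to the product of the `T s`. Since it
respects degrees, it restricts to the parts of degree `g`, and dimensions can be compared there. -/
theorem card_fiber_eq_sum_finrank {K A B S : Type*} [Field K] [DecidableEq A] [Fintype B]
    [Fintype S] [DecidableEq B] [DecidableEq S] {T : S → Type*} [∀ s, AddCommGroup (T s)]
    [∀ s, Module K (T s)] [∀ s, Module.Finite K (T s)] (degB : B → A) (degS : S → A)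
    (τ : B → ∀ s, T s) (hdeg : ∀ b s, τ b s ≠ 0 → degS s = degB b)
    (hinj : ∀ y : B → K, (∀ s, ∑ b, y b • τ b s = 0) → y = 0)
    (hsurj : ∀ c : ∀ s, T s, ∃ y : B → K, ∀ s, ∑ b, y b • τ b s = c s) (g : A) :
    Nat.card {b // degB b = g} = ∑ s, if degS s = g then Module.finrank K (T s) else 0 := by
  let Λ : ({b // degB b = g} → K) →ₗ[K] ∀ s : {s // degS s = g}, T s :=
    { toFun := fun y s => ∑ b, y b • τ b s
      map_add' := fun y y' => by
        funext s
        simp [add_smul, Finset.sum_add_distrib]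
      map_smul' := fun x y => by
        funext s
        simp [mul_smul, Finset.smul_sum] }
  have hrestrict : ∀ (y : B → K) (s : S), degS s = g →
      ∑ b, y b • τ b s = ∑ b : {b // degB b = g}, y b • τ b s := by
    intro y s hs
    rw [← Finset.sum_filter_of_ne (p := fun b => degB b = g)]
    · exact Finset.sum_subtype _ (by simp) fun b => y b • τ b s
    · intro b _ hb
      rw [← hs, hdeg b s (right_ne_zero_of_smul hb)]
  have hΛ : Function.Bijective Λ := by
    constructor
    · rw [← LinearMap.ker_eq_bot, LinearMap.ker_eq_bot']
      intro y hy
      have h := hinj (fun b => if h : degB b = g then y ⟨b, h⟩ else 0) fun s => by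
        by_cases hs : degS s = g
        · rw [hrestrict _ s hs]
          have := congrFun hy ⟨s, hs⟩
          refine Eq.trans ?_ this
          refine Finset.sum_congr rfl fun b _ => ?_
          rw [dif_pos b.2]
        · refine Finset.sum_eq_zero fun b _ => ?_
          by_cases hb : degB b = g
          · have : τ b s = 0 := by
              by_contra hne
              exact hs ((hdeg b s hne).trans hb)
            rw [this, smul_zero]
          · rw [dif_neg hb, zero_smul]
      funext b
      simpa [b.2] using congrFun h b
    · intro c
      obtain ⟨y, hy⟩ := hsurj fun s => if h : degS s = g then c ⟨s, h⟩ else 0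
      refine ⟨fun b => y b, ?_⟩
      funext s
      have := hy s
      rw [hrestrict y s s.2, dif_pos s.2] at this
      exact this
  have h := (LinearEquiv.ofBijective Λ hΛ).finrank_eq
  rw [Module.finrank_fintype_fun_eq_card, Module.finrank_pi_fintype] at h
  rw [Nat.card_eq_fintype_card, h, ← Finset.sum_filter]
  exact (Finset.sum_subtype (Finset.univ.filter fun s => degS s = g) (by simp)
    fun s => Module.finrank K (T s)).symm

variable {K E A : Type*} [Field K] [Fintype E] [DecidableEq E] [AddCommMonoid A] {w : E → A}
  {I : Ideal (MvPolynomial E K)}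

theorem subsetDegree_apply (σ : Finset E) (e : E) :
    subsetDegree σ e = if e ∈ σ then 1 else 0 := by
  unfold subsetDegree
  rw [Finsupp.finsetSum_apply]
  simp [Finsupp.single_apply]

theorem support_subsetDegree (σ : Finset E) : (subsetDegree σ).support = σ := by
  ext e
  simp [subsetDegree_apply]

theorem subsetDegree_injective : Function.Injective (subsetDegree (E := E)) := fun σ τ h => by
  rw [← support_subsetDegree σ, h, support_subsetDegree]

theorem eq_subsetDegree_of_le_one {α : E →₀ ℕ} (h : ∀ e, α e ≤ 1) :
    α = subsetDegree α.support := by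
  ext e
  rw [subsetDegree_apply]
  have := h e
  split_ifs with he
  · have := Finsupp.mem_support_iff.1 he
    omega
  · exact Finsupp.notMem_support_iff.1 he

/-- Some generator must hit a unit modulo the variables; it has degree zero, and by `hw` its image
is represented by a constant. A second generator would be a multiple of it modulo `I`, a relation
with coefficient `1`, against minimality. -/
theorem MinimalGradedFreeResolution.exists_generator (Φ : MinimalGradedFreeResolution w I)
    (hI : ∀ f ∈ I, constantCoeff f = 0) (hw : ∀ m : E →₀ ℕ, Finsupp.weight w m = 0 → m = 0) :
    ∃ a₀, (∀ a, a = a₀) ∧ Φ.deg 0 a₀ = 0 ∧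
      ∃ c : K, c ≠ 0 ∧ Φ.aug a₀ = Ideal.Quotient.mk I (C c) := by
  choose p hp hpaug using Φ.aug_homogeneous
  obtain ⟨x, hx⟩ := Φ.aug_surjective 1
  have hmem : ∑ a, x a * p a - 1 ∈ I := by
    rw [← Ideal.Quotient.eq_zero_iff_mem, map_sub, map_one, ← hx, map_sum, sub_eq_zero]
    refine Finset.sum_congr rfl fun a _ => ?_
    rw [← hpaug, ← smul_one_eq_quotient_mk, ← smul_one_eq_quotient_mk, smul_smul]
  have h1 := hI _ hmem
  rw [map_sub, map_one, sub_eq_zero, map_sum] at h1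
  obtain ⟨a₀, -, ha₀⟩ : ∃ a ∈ Finset.univ, constantCoeff (x a * p a) ≠ 0 :=
    Finset.exists_ne_zero_of_sum_ne_zero (by rw [h1]; exact one_ne_zero)
  rw [map_mul] at ha₀
  have hc := right_ne_zero_of_mul ha₀
  have hdeg : Φ.deg 0 a₀ = 0 := by rw [← hp a₀ hc, map_zero]
  have hpC : p a₀ = C (constantCoeff (p a₀)) := by
    ext m
    rw [coeff_C]
    split_ifs with hm
    · rw [← hm]
      rfl
    · by_contra hne
      exact hm (hw m ((hp a₀ hne).trans hdeg)).symm
  refine ⟨a₀, fun a => ?_, hdeg, constantCoeff (p a₀), hc, by rw [← hpC, hpaug]⟩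
  by_contra hne
  have hker : ∑ i, (Pi.single a 1 - Pi.single a₀ (C (constantCoeff (p a₀))⁻¹ * p a) :
      Fin (Φ.rank 0) → MvPolynomial E K) i • Φ.aug i = 0 := by
    have h2 : Φ.aug a = (C (constantCoeff (p a₀))⁻¹ * p a) • Φ.aug a₀ := by
      rw [← hpaug a₀, ← hpaug a, hpC, ← smul_one_eq_quotient_mk, ← smul_one_eq_quotient_mk,
        smul_smul, mul_right_comm, ← C_mul, constantCoeff_C, inv_mul_cancel₀ hc, C_1, one_mul]
    simp [sub_smul, Pi.single_apply, ite_smul, h2]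
  obtain ⟨y, hy⟩ := (Φ.exact_zero _).1 hker
  have h3 := congrArg constantCoeff (congrFun hy a)
  simp [Matrix.mulVec, dotProduct, Φ.minimal, hne] at h3

/-- The second Betti numbers of a squarefree monomial ideal are the dimensions of its Koszul
homology in squarefree degrees. -/
theorem MinimalGradedFreeResolution.multiplicity_two [DecidableEq A]
    (Φ : MinimalGradedFreeResolution w I) (hw : ∀ m : E →₀ ℕ, Finsupp.weight w m = 0 → m = 0)
    {dep : Finset E → Prop} (hmono : ∀ σ τ, σ ⊆ τ → dep σ → dep τ) (hempty : ¬ dep ∅)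
    (hI : ∀ f, f ∈ I ↔ ∀ m ∈ f.support, dep m.support) (g : A) :
    Φ.multiplicity 2 g = ∑ σ : Finset E, if Finsupp.weight w (subsetDegree σ) = g then
      Module.finrank K (KoszulHomology K dep (subsetDegree σ)) else 0 := by
  have hI0 : ∀ f ∈ I, constantCoeff f = 0 := by
    intro f hf
    by_contra hne
    exact hempty (by simpa using (hI f).1 hf 0 (mem_support_iff.2 hne))
  obtain ⟨a₀, huniq, hdeg0, c₀, hc₀, haug⟩ := Φ.exists_generator hI0 hw
  let φ : (Fin (Φ.rank 1) → MvPolynomial E K) →ₗ[MvPolynomial E K] MvPolynomial E K :=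
    LinearMap.proj a₀ ∘ₗ (Φ.d 0).mulVecLin
  have hφ : ∀ t, φ t = (Φ.d 0 *ᵥ t) a₀ := fun t => rfl
  have hφ_sum : ∀ t, φ t = ∑ a, Φ.d 0 a₀ a * t a := fun t => rfl
  have hφ_iff : ∀ t, φ t = 0 ↔ ∃ y, Φ.d 1 *ᵥ y = t := by
    intro t
    rw [← Φ.exact_succ 0 t, hφ]
    refine ⟨fun h => ?_, fun h => by rw [h]; rfl⟩
    funext a
    rw [huniq a, h]
    rfl
  have haug_sum : ∀ x : Fin (Φ.rank 0) → MvPolynomial E K,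
      ∑ a, x a • Φ.aug a = 0 ↔ x a₀ ∈ I := by
    intro x
    have : Finset.univ = {a₀} := by
      ext a
      simp [huniq a]
    rw [this, Finset.sum_singleton, haug, ← smul_one_eq_quotient_mk, smul_smul,
      smul_one_eq_quotient_mk, Ideal.Quotient.eq_zero_iff_mem]
    refine ⟨fun h => ?_, fun h => I.mul_mem_right _ h⟩
    have h2 := I.mul_mem_right (C c₀⁻¹) h
    rwa [mul_assoc, ← C_mul, mul_inv_cancel₀ hc₀, C_1, mul_one] at h2
  have hφ_mem : ∀ t, φ t ∈ I := by
    intro t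
    rw [hφ, ← haug_sum]
    exact (Φ.exact_zero _).2 ⟨t, rfl⟩
  have hφ_surj : ∀ f ∈ I, ∃ t, φ t = f := by
    intro f hf
    obtain ⟨t, ht⟩ := (Φ.exact_zero fun _ => f).1 ((haug_sum _).2 hf)
    exact ⟨t, by rw [hφ, ht]⟩
  have hker : ∀ y, Φ.d 1 *ᵥ y = 0 → ∀ b, constantCoeff (y b) = 0 := by
    intro y hy b
    obtain ⟨z, rfl⟩ := (Φ.exact_succ 1 y).1 hy
    simp [Matrix.mulVec, dotProduct, Φ.minimal]
  -- By minimality each column of `d 1` is `∑ X_e t_e`. Applying `φ` to the `t_e` gives a Koszul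
  -- `1`-cycle with coefficients in `I`, the class attached to the basis element `b`.
  choose s hs hs' using fun (a : Fin (Φ.rank 1)) (b : Fin (Φ.rank 2)) =>
    exists_sum_X_mul (Φ.d 1 a b) (Φ.minimal 1 a b)
  let t : Fin (Φ.rank 2) → E → Fin (Φ.rank 1) → MvPolynomial E K := fun b e a => s a b e
  have ht : ∀ b, ∑ e, (X e : MvPolynomial E K) • t b e = (Φ.d 1).col b := by
    intro b
    funext a
    rw [Finset.sum_apply]
    exact hs a b
  have ht_cycle : ∀ b, ∑ e, X e * φ (t b e) = 0 := by
    intro b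
    simp_rw [← smul_eq_mul, ← map_smul]
    rw [← map_sum, ht, hφ_iff]
    exact ⟨_, (Φ.d 1).mulVec_single_one b⟩
  have hκ : ∀ b α, koszulCoeff α (fun e => φ (t b e)) ∈ koszulCycle K dep α := fun b α =>
    koszulCoeff_mem_koszulCycle hI (fun e => hφ_mem _) (ht_cycle b) α
  let κ : Fin (Φ.rank 2) → ∀ σ : Finset E, KoszulHomology K dep (subsetDegree σ) := fun b σ =>
    Submodule.Quotient.mk ⟨_, hκ b (subsetDegree σ)⟩
  have hmk : ∀ (y : Fin (Φ.rank 2) → K) (σ : Finset E)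
      (c : koszulCycle K dep (subsetDegree σ)),
      ∑ b, y b • κ b σ = Submodule.Quotient.mk c ↔
        (∑ b, y b • koszulCoeff (subsetDegree σ) fun e => φ (t b e)) - c.1 ∈
          koszulBoundary K dep (subsetDegree σ) := by
    intro y σ c
    have : ∑ b, y b • κ b σ = Submodule.Quotient.mk
        (∑ b, y b • (⟨_, hκ b (subsetDegree σ)⟩ : koszulCycle K dep (subsetDegree σ))) := by
      simp only [κ, ← Submodule.Quotient.mk_smul]
      exact (map_sum (Submodule.mkQ _) _ _).symm
    rw [this, Submodule.Quotient.eq, Submodule.submoduleOf, Submodule.mem_comap]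
    simp
  have hlin : ∀ (y : Fin (Φ.rank 2) → K) (α : E →₀ ℕ),
      ∑ b, y b • koszulCoeff α (fun e => φ (t b e)) =
        koszulCoeff α fun e => φ (∑ b, (C (y b) : MvPolynomial E K) • t b e) := by
    intro y α
    simp_rw [← map_smul]
    rw [← map_sum]
    congr 1
    funext e
    rw [Finset.sum_apply, map_sum]
    refine Finset.sum_congr rfl fun b _ => ?_
    rw [map_smul, Pi.smul_apply, smul_eq_C_mul, smul_eq_mul]
  have hX : ∀ y : Fin (Φ.rank 2) → K, ∑ e, (X e : MvPolynomial E K) •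
      ∑ b, (C (y b) : MvPolynomial E K) • t b e = Φ.d 1 *ᵥ fun b => C (y b) := by
    intro y
    simp_rw [Finset.smul_sum, smul_comm (X _ : MvPolynomial E K)]
    rw [Finset.sum_comm]
    simp_rw [← Finset.smul_sum, ht]
    rw [mulVec_eq_sum_col]
  unfold MinimalGradedFreeResolution.multiplicity
  refine card_fiber_eq_sum_finrank (Φ.deg 2) (fun σ => Finsupp.weight w (subsetDegree σ)) κ
    ?_ ?_ ?_ g
  -- Degrees: a nonzero coefficient in degree `σ` comes from a monomial of `d 0` times one of `d 1`,
  -- by `hs'`. Their weights add up to the degree of `b`.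
  · intro b σ hne
    have hne' : koszulCoeff (subsetDegree σ) (fun e => φ (t b e)) ≠ 0 := by
      intro h
      refine hne ((Submodule.Quotient.mk_eq_zero _).2 ?_)
      rw [Submodule.submoduleOf, Submodule.mem_comap]
      simp [h]
    obtain ⟨e, he⟩ := Function.ne_iff.1 hne'
    rw [koszulCoeff_apply, hφ_sum, Finset.mul_sum, coeff_sum] at he
    obtain ⟨a, -, ha⟩ := Finset.exists_ne_zero_of_sum_ne_zero he
    rw [mul_left_comm, coeff_mul] at ha
    obtain ⟨p, hp, hp'⟩ := Finset.exists_ne_zero_of_sum_ne_zero ha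
    have h1 := left_ne_zero_of_mul hp'
    have h2 := hs' a b e _ (right_ne_zero_of_mul hp')
    obtain ⟨s₁, hs₁, hhom₁⟩ := Φ.d_homogeneous 0 a₀ a fun h => h1 (by rw [h, coeff_zero])
    obtain ⟨s₂, hs₂, hhom₂⟩ := Φ.d_homogeneous 1 a b fun h => h2 (by rw [h, coeff_zero])
    rw [← Finset.HasAntidiagonal.mem_antidiagonal.1 hp, map_add, hhom₁ h1, hhom₂ h2, ← hs₂]
    rw [hdeg0, zero_add] at hs₁
    rw [hs₁]
  -- Injectivity: a combination that bounds lifts to a cycle `t'` in `F_1`. Subtracting it leaves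
  -- elements of the image of `d 1`, so `y - ∑ X_e z_e` is killed by `d 1`, and minimality forces
  -- the constants `y` to vanish.
  · intro y hy
    obtain ⟨t', ht', ht''⟩ := exists_lift_of_koszulBoundary φ hI hφ_surj
      (fun e => φ (∑ b, (C (y b) : MvPolynomial E K) • t b e)) (fun α => by
        by_cases hα : ∀ e, α e ≤ 1
        · have h := (hmk y α.support 0).1 (hy _)
          rwa [hlin, Submodule.coe_zero, sub_zero, ← eq_subsetDegree_of_le_one hα] at h
        · push Not at hα
          obtain ⟨e, he⟩ := hα
          rw [← hlin]
          exact koszulCycle_le_koszulBoundary_of_two_le he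
            (Submodule.sum_mem _ fun b _ => Submodule.smul_mem _ _ (hκ b α)))
    have hdiff : ∀ e, φ ((∑ b, (C (y b) : MvPolynomial E K) • t b e) - t' e) = 0 := fun e => by
      rw [map_sub, ht', sub_self]
    choose z hz using fun e => (hφ_iff _).1 (hdiff e)
    have h0 : Φ.d 1 *ᵥ ((fun b => C (y b)) - ∑ e, (X e : MvPolynomial E K) • z e) = 0 := by
      rw [Matrix.mulVec_sub, ← hX, Matrix.mulVec_sum]
      simp_rw [Matrix.mulVec_smul, hz, smul_sub]
      rw [Finset.sum_sub_distrib, ht'', sub_zero, sub_self]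
    funext b
    simpa [Finset.sum_apply] using hker _ h0 b
  -- Surjectivity: realise the classes by one cycle `u` in `I` and lift it to `T`. Then `∑ X_e T_e`
  -- lies in the kernel of `φ`, hence equals `d 1 *ᵥ y`, and the constant terms of `y` are the
  -- required coefficients.
  · intro c
    choose c' hc' using fun σ => Submodule.Quotient.mk_surjective _ (c σ)
    let u : E → MvPolynomial E K := ∑ σ : Finset E, koszulMonomial (subsetDegree σ) (c' σ).1
    have hu : ∀ e, u e ∈ I := fun e => by
      simp only [u, Finset.sum_apply]
      exact I.sum_mem fun σ _ => koszulMonomial_mem hI (c' σ).2 e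
    have huX : ∑ e, X e * u e = 0 := by
      simp only [u, Finset.sum_apply, Finset.mul_sum]
      rw [Finset.sum_comm]
      exact Finset.sum_eq_zero fun σ _ => sum_X_mul_koszulMonomial (c' σ).2
    have huc : ∀ σ, koszulCoeff (subsetDegree σ) u = (c' σ).1 := fun σ => by
      simp only [u, map_sum]
      rw [Finset.sum_eq_single σ, koszulCoeff_koszulMonomial_self (c' σ).2]
      · intro τ _ hne
        exact koszulCoeff_koszulMonomial_of_ne (fun h => hne (subsetDegree_injective h)) _
      · simp
    choose T hT using fun e => hφ_surj (u e) (hu e)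
    obtain ⟨y, hy⟩ := (hφ_iff (∑ e, (X e : MvPolynomial E K) • T e)).1 <| by
      rw [map_sum]
      simp_rw [map_smul, hT, smul_eq_mul]
      exact huX
    choose v hv _ using fun b => exists_sum_X_mul (y b - C (constantCoeff (y b))) (by simp)
    refine ⟨fun b => constantCoeff (y b), fun σ => ?_⟩
    rw [← hc' σ, hmk, hlin, ← huc, ← map_sub]
    have h := koszulCoeff_comp_mem_koszulBoundary φ hmono hI hφ_mem
      (fun e => (∑ b, (C (constantCoeff (y b)) : MvPolynomial E K) • t b e) +
        (Φ.d 1 *ᵥ fun b => v b e) - T e) ?_ (subsetDegree σ)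
    · convert h using 2
      funext e
      rw [Pi.sub_apply, map_sub, map_add, hT, (hφ_iff (Φ.d 1 *ᵥ fun b => v b e)).2 ⟨_, rfl⟩,
        add_zero]
    · simp_rw [smul_sub, smul_add, Finset.sum_sub_distrib, Finset.sum_add_distrib]
      rw [hX fun b => constantCoeff (y b), ← hy]
      simp_rw [← Matrix.mulVec_smul]
      rw [← Matrix.mulVec_sum, ← Matrix.mulVec_add, ← Matrix.mulVec_sub]
      refine Eq.trans (congrArg _ ?_) (Matrix.mulVec_zero (Φ.d 1))
      funext b
      simp [Finset.sum_apply, hv]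

end SecondBetti

/-! ### Koszul homology in squarefree degrees as reduced homology of a graph -/

section Components

set_option linter.unusedSectionVars false

variable {K E : Type*} [Field K] [Fintype E] [DecidableEq E]

theorem subsetDegree_erase_add {σ : Finset E} {e : E} (he : e ∈ σ) :
    subsetDegree (σ.erase e) + Finsupp.single e 1 = subsetDegree σ :=
  Finset.sum_erase_add σ _ he

theorem add_single_eq_subsetDegree_iff {σ : Finset E} {e : E} {γ : E →₀ ℕ} :
    γ + Finsupp.single e 1 = subsetDegree σ ↔ e ∈ σ ∧ γ = subsetDegree (σ.erase e) := by
  constructor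
  · intro h
    have he : e ∈ σ := by
      rw [← support_subsetDegree σ, ← h]
      simp
    refine ⟨he, add_right_cancel (h.trans (subsetDegree_erase_add he).symm)⟩
  · rintro ⟨he, rfl⟩
    exact subsetDegree_erase_add he

theorem mem_koszulCycle_subsetDegree {dep : Finset E → Prop} {σ : Finset E} {c : E → K} :
    c ∈ koszulCycle K dep (subsetDegree σ) ↔
      ∑ e, c e = 0 ∧ ∀ e, c e ≠ 0 → e ∈ σ ∧ dep (σ.erase e) := by
  refine and_congr Iff.rfl (forall₂_congr fun e _ => ?_)
  simp_rw [add_single_eq_subsetDegree_iff]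
  constructor
  · rintro ⟨γ, h, he, rfl⟩
    rw [support_subsetDegree] at h
    exact ⟨he, h⟩
  · rintro ⟨he, h⟩
    exact ⟨_, by rwa [support_subsetDegree], he, rfl⟩

theorem single_sub_single_mem_koszulBoundary {dep : Finset E → Prop} {σ : Finset E} {e e' : E}
    (he : e ∈ σ) (he' : e' ∈ σ) (hne : e ≠ e') (h : dep ((σ.erase e).erase e')) :
    (Pi.single e 1 - Pi.single e' 1 : E → K) ∈ koszulBoundary K dep (subsetDegree σ) := by
  refine Submodule.subset_span ⟨e, e', subsetDegree ((σ.erase e).erase e'), ?_, ?_, rfl⟩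
  · rwa [support_subsetDegree]
  · rw [add_right_comm, subsetDegree_erase_add (Finset.mem_erase.2 ⟨hne.symm, he'⟩),
      subsetDegree_erase_add he]

theorem koszulBoundary_subsetDegree_le {dep : Finset E → Prop} {σ : Finset E}
    {N : Submodule K (E → K)} (h : ∀ e ∈ σ, ∀ e' ∈ σ, e ≠ e' → dep ((σ.erase e).erase e') →
      (Pi.single e 1 - Pi.single e' 1 : E → K) ∈ N) :
    koszulBoundary K dep (subsetDegree σ) ≤ N := by
  unfold koszulBoundary
  rw [Submodule.span_le]
  rintro _ ⟨e, e', γ, hγ, hsum, rfl⟩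
  obtain ⟨he', hsum⟩ := add_single_eq_subsetDegree_iff.1 hsum
  obtain ⟨he, rfl⟩ := add_single_eq_subsetDegree_iff.1 hsum
  rw [support_subsetDegree, Finset.erase_right_comm] at hγ
  exact h e (Finset.mem_of_mem_erase he) e' he' (Finset.ne_of_mem_erase he) hγ

/-- A graph in which any two vertices are adjacent has no reduced zeroth homology; the empty graph
is included. -/
theorem finrank_koszulHomology_eq_zero {dep : Finset E → Prop} {σ : Finset E}
    (h : ∀ e ∈ σ, ∀ e' ∈ σ, e ≠ e' → dep (σ.erase e) → dep (σ.erase e') →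
      dep ((σ.erase e).erase e')) :
    Module.finrank K (KoszulHomology K dep (subsetDegree σ)) = 0 := by
  have hle : koszulCycle K dep (subsetDegree σ) ≤ koszulBoundary K dep (subsetDegree σ) := by
    intro c hc
    rw [mem_koszulCycle_subsetDegree] at hc
    by_cases h0 : ∃ e₀, c e₀ ≠ 0
    · obtain ⟨e₀, he₀⟩ := h0
      refine mem_of_single_sub_single_mem _ c hc.1 e₀ fun e he hne => ?_
      exact single_sub_single_mem_koszulBoundary (hc.2 e he).1 (hc.2 e₀ he₀).1 hne
        (h e (hc.2 e he).1 e₀ (hc.2 e₀ he₀).1 hne (hc.2 e he).2 (hc.2 e₀ he₀).2)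
    · push Not at h0
      rw [show c = 0 from funext h0]
      exact Submodule.zero_mem _
  have : Subsingleton (KoszulHomology K dep (subsetDegree σ)) := by
    rw [Submodule.Quotient.subsingleton_iff, Submodule.submoduleOf_eq_top]
    exact hle
  exact Module.finrank_zero_of_subsingleton

/-- If all elements of `σ` are vertices, the Koszul homology in degree `σ` has dimension one less
than the number of connected components of the graph in which two elements are adjacent if
removing both from `σ` leaves a dependent set. -/
theorem finrank_koszulHomology_add_one {dep : Finset E → Prop} {σ : Finset E} {ι : Type*}
    [Fintype ι] [DecidableEq ι] [Nonempty ι] (κ : E → ι) (hvert : ∀ e ∈ σ, dep (σ.erase e))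
    (hsurj : ∀ i, ∃ e ∈ σ, κ e = i)
    (hadj : ∀ e ∈ σ, ∀ e' ∈ σ, e ≠ e' → (dep ((σ.erase e).erase e') ↔ κ e = κ e')) :
    Module.finrank K (KoszulHomology K dep (subsetDegree σ)) + 1 = Fintype.card ι := by
  choose s hs hκs using hsurj
  -- Summing over the fibres of `κ` maps cycles onto the vectors of sum zero in `K^ι`, with the
  -- boundaries as kernel.
  let fib : (E → K) →ₗ[K] (ι → K) :=
    { toFun := fun c i => ∑ e with κ e = i, c e
      map_add' := fun c c' => by
        funext i
        simp [Finset.sum_add_distrib]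
      map_smul' := fun x c => by
        funext i
        simp [Finset.mul_sum] }
  have hfib : ∀ c i, fib c i = ∑ e with κ e = i, c e := fun _ _ => rfl
  have hfib_single : ∀ e, fib (Pi.single e 1) = Pi.single (κ e) 1 := by
    intro e
    funext i
    rw [hfib, Finset.sum_pi_single']
    simp [Pi.single_apply, eq_comm]
  let total : (ι → K) →ₗ[K] K := ∑ i, LinearMap.proj i
  have htotal : ∀ f, total f = ∑ i, f i := fun f => by simp [total]
  have hmaps : ∀ c ∈ koszulCycle K dep (subsetDegree σ), fib c ∈ LinearMap.ker total := by
    intro c hc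
    rw [LinearMap.mem_ker, htotal]
    simp_rw [hfib]
    rw [Finset.sum_fiberwise, hc.1]
  let Ψ := fib.restrict hmaps
  have hΨ_surj : Function.Surjective Ψ := by
    rintro ⟨f, hf⟩
    rw [LinearMap.mem_ker, htotal] at hf
    have hsum : fib (∑ i, f i • Pi.single (s i) 1) = f := by
      simp_rw [map_sum, map_smul, hfib_single, hκs]
      funext i
      simp [Finset.sum_apply, Pi.single_apply]
    refine ⟨⟨∑ i, f i • Pi.single (s i) 1, mem_koszulCycle_subsetDegree.2 ⟨?_, fun e he => ?_⟩⟩,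
      Subtype.ext hsum⟩
    · simp only [Finset.sum_apply]
      rw [Finset.sum_comm]
      simpa [Pi.single_apply] using hf
    · rw [Finset.sum_apply] at he
      obtain ⟨i, -, hi⟩ := Finset.exists_ne_zero_of_sum_ne_zero he
      have : e = s i := by
        by_contra hne
        exact hi (by simp [hne])
      rw [this]
      exact ⟨hs i, hvert _ (hs i)⟩
  have hker : LinearMap.ker Ψ =
      (koszulBoundary K dep (subsetDegree σ)).submoduleOf
        (koszulCycle K dep (subsetDegree σ)) := by
    apply le_antisymm
    · rintro ⟨c, hc⟩ hz
      have hz' : fib c = 0 := congrArg Subtype.val (LinearMap.mem_ker.1 hz)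
      rw [mem_koszulCycle_subsetDegree] at hc
      change c ∈ koszulBoundary K dep (subsetDegree σ)
      -- The fibre sums vanish, so each entry may be moved to the representative of its fibre; the
      -- differences are edges.
      have hsum : c = ∑ e, c e • ((Pi.single e 1 : E → K) - Pi.single (s (κ e)) 1) := by
        have h2 : ∑ e, c e • (Pi.single (s (κ e)) 1 : E → K) = 0 := by
          rw [← Finset.sum_fiberwise Finset.univ κ]
          refine Finset.sum_eq_zero fun i _ => ?_
          have h3 : ∑ e with κ e = i, c e • (Pi.single (s (κ e)) 1 : E → K) =
              ∑ e with κ e = i, c e • (Pi.single (s i) 1 : E → K) :=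
            Finset.sum_congr rfl fun e he => by rw [(Finset.mem_filter.1 he).2]
          rw [h3, ← Finset.sum_smul, ← hfib, hz', Pi.zero_apply, zero_smul]
        simp_rw [smul_sub, Finset.sum_sub_distrib]
        rw [h2, sub_zero]
        funext i
        simp [Finset.sum_apply, Pi.single_apply]
      rw [hsum]
      refine Submodule.sum_mem _ fun e _ => ?_
      by_cases h0 : c e = 0
      · simp [h0]
      · by_cases hne : e = s (κ e)
        · rw [← hne, sub_self, smul_zero]
          exact Submodule.zero_mem _
        · refine Submodule.smul_mem _ _ (single_sub_single_mem_koszulBoundary (hc.2 e h0).1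
            (hs _) hne ((hadj _ (hc.2 e h0).1 _ (hs _) hne).2 (hκs _).symm))
    · have hle : koszulBoundary K dep (subsetDegree σ) ≤ LinearMap.ker fib := by
        refine koszulBoundary_subsetDegree_le fun e he e' he' hne h => ?_
        rw [LinearMap.mem_ker, map_sub, hfib_single, hfib_single,
          (hadj e he e' he' hne).1 h, sub_self]
      rintro ⟨c, hc⟩ hz
      exact LinearMap.mem_ker.2 (Subtype.ext (LinearMap.mem_ker.1 (hle hz)))
  have hfin : Module.finrank K (KoszulHomology K dep (subsetDegree σ)) =
      Module.finrank K (LinearMap.ker total) := by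
    unfold KoszulHomology
    rw [← hker]
    exact (Ψ.quotKerEquivOfSurjective hΨ_surj).finrank_eq
  have htot_surj : Function.Surjective total := by
    intro x
    obtain ⟨i⟩ := ‹Nonempty ι›
    exact ⟨Pi.single i x, by simp [htotal]⟩
  have h := total.finrank_range_add_finrank_ker
  rw [LinearMap.range_eq_top.2 htot_surj, finrank_top, Module.finrank_self,
    Module.finrank_fintype_fun_eq_card] at h
  rw [hfin, add_comm, h]

/-- A monomial lies in the ideal when a generator divides it, and supersets of dependent sets are
dependent, so its support decides membership. -/
theorem mem_stanleyReisnerIdeal_iff {M : Matroid E} (hM : M.E = Set.univ)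
    (f : MvPolynomial E K) :
    f ∈ stanleyReisnerIdeal K M ↔ ∀ m ∈ f.support, M.Dep (m.support : Set E) := by
  have hspan : stanleyReisnerIdeal K M = Ideal.span ((fun m => MvPolynomial.monomial m (1 : K)) ''
      {m | ∃ σ : Finset E, M.Dep (σ : Set E) ∧ m = subsetDegree σ}) := by
    unfold stanleyReisnerIdeal
    congr 1
    have hmon : ∀ σ : Finset E, MvPolynomial.monomial (subsetDegree σ) (1 : K) =
        ∏ e ∈ σ, MvPolynomial.X e := fun σ => MvPolynomial.monomial_sum_one _ _
    ext p
    constructor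
    · rintro ⟨σ, hσ, rfl⟩
      exact ⟨_, ⟨σ, hσ, rfl⟩, hmon σ⟩
    · rintro ⟨_, ⟨σ, hσ, rfl⟩, rfl⟩
      exact ⟨σ, hσ, hmon σ⟩
  rw [hspan, MvPolynomial.mem_ideal_span_monomial_image]
  refine forall₂_congr fun m _ => ?_
  constructor
  · rintro ⟨_, ⟨σ, hσ, rfl⟩, hle⟩
    refine hσ.superset ?_ (by rw [hM]; exact Set.subset_univ _)
    intro e he
    have := hle e
    rw [subsetDegree_apply, if_pos (Finset.mem_coe.1 he)] at this
    exact Finsupp.mem_support_iff.2 (Nat.one_le_iff_ne_zero.1 this)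
  · intro h
    refine ⟨_, ⟨m.support, h, rfl⟩, fun e => ?_⟩
    rw [subsetDegree_apply]
    split_ifs with he
    · exact Nat.one_le_iff_ne_zero.2 (Finsupp.mem_support_iff.1 he)
    · exact Nat.zero_le _

end Components

/-! ### Conics in the projective plane and their pencils -/

section Conics

set_option linter.unusedSectionVars false

open Module

/-- `v` enumerates the points of the projective space of `V` by representing vectors. -/
structure IsPointEnumeration (F : Type*) {E V : Type*} [Field F] [AddCommGroup V] [Module F V]
    (v : E → V) : Prop where
  ne_zero : ∀ e, v e ≠ 0
  injective : ∀ e e' (c : F), v e = c • v e' → e = e'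
  surjective : ∀ u : V, u ≠ 0 → ∃ e, ∃ c : F, c ≠ 0 ∧ v e = c • u

variable {F E V : Type*} [Field F] [AddCommGroup V] [Module F V] {v : E → V}

theorem IsPointEnumeration.linearIndependent (hv : IsPointEnumeration F v) {e e' : E}
    (hne : e ≠ e') : LinearIndependent F ![v e, v e'] := by
  rw [LinearIndependent.pair_iff' (hv.ne_zero e)]
  intro a h
  exact hne (hv.injective e' e a h.symm).symm

theorem exists_dual_ne_zero (h3 : finrank F V = 3) (x y : V) :
    ∃ ℓ : Dual F V, ℓ ≠ 0 ∧ ℓ x = 0 ∧ ℓ y = 0 := by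
  classical
  have : Module.Finite F V := Module.finite_of_finrank_pos (by omega)
  have hlt : Submodule.span F ({x, y} : Set V) < ⊤ := by
    refine lt_top_iff_ne_top.2 fun h => ?_
    have h1 := finrank_span_finset_le_card (R := F) ({x, y} : Finset V)
    have h2 := Finset.card_le_two (a := x) (b := y)
    rw [Set.finrank, Finset.coe_insert, Finset.coe_singleton, h, finrank_top, h3] at h1
    omega
  obtain ⟨ℓ, hℓ, hle⟩ := Submodule.exists_le_ker_of_lt_top _ hlt
  exact ⟨ℓ, hℓ, hle (Submodule.subset_span (by simp)), hle (Submodule.subset_span (by simp))⟩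

theorem finrank_ker_dual (h3 : finrank F V = 3) {ℓ : Dual F V} (hℓ : ℓ ≠ 0) :
    finrank F (LinearMap.ker ℓ) = 2 := by
  have : Module.Finite F V := Module.finite_of_finrank_pos (by omega)
  have := Module.Dual.finrank_ker_add_one_of_ne_zero hℓ
  omega

theorem IsPointEnumeration.exists_eq_of_mem_ker (hv : IsPointEnumeration F v)
    (h3 : finrank F V = 3) {ℓ : Dual F V} (hℓ : ℓ ≠ 0) {e e' : E} (hne : e ≠ e')
    (he : ℓ (v e) = 0) (he' : ℓ (v e') = 0) {x : V} (hx : ℓ x = 0) :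
    ∃ a b : F, x = a • v e + b • v e' := by
  have : Module.Finite F V := Module.finite_of_finrank_pos (by omega)
  have hspan : Submodule.span F (Set.range ![v e, v e']) = LinearMap.ker ℓ := by
    apply Submodule.eq_of_le_of_finrank_eq
    · rw [Submodule.span_le]
      rintro _ ⟨i, rfl⟩
      fin_cases i
      · exact he
      · exact he'
    · rw [finrank_span_eq_card (hv.linearIndependent hne), finrank_ker_dual h3 hℓ,
        Fintype.card_fin]
  have hmem : x ∈ Submodule.span F (Set.range ![v e, v e']) := by
    rw [hspan]
    exact hx
  rw [Matrix.range_cons, Matrix.range_cons, Matrix.range_empty, Set.union_empty,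
    Set.singleton_union, Submodule.mem_span_pair] at hmem
  obtain ⟨a, b, h⟩ := hmem
  exact ⟨a, b, h.symm⟩

theorem exists_apply_eq_one {ℓ : Dual F V} (hℓ : ℓ ≠ 0) : ∃ c, ℓ c = 1 := by
  obtain ⟨x, hx⟩ := DFunLike.ne_iff.1 hℓ
  exact ⟨(ℓ x)⁻¹ • x, by rw [map_smul, smul_eq_mul, inv_mul_cancel₀ hx]⟩

theorem IsPointEnumeration.exists_eq_smul_dual (hv : IsPointEnumeration F v)
    (h3 : finrank F V = 3) {ℓ m : Dual F V} (hℓ : ℓ ≠ 0) {e e' : E} (hne : e ≠ e')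
    (he : ℓ (v e) = 0) (he' : ℓ (v e') = 0) (hm : m (v e) = 0) (hm' : m (v e') = 0) :
    ∃ a : F, m = a • ℓ := by
  obtain ⟨c, hc⟩ := exists_apply_eq_one hℓ
  refine ⟨m c, LinearMap.ext fun x => ?_⟩
  obtain ⟨a, b, h⟩ := hv.exists_eq_of_mem_ker h3 hℓ hne he he' (x := x - ℓ x • c)
    (by rw [map_sub, map_smul, hc, smul_eq_mul, mul_one, sub_self])
  have h2 := congrArg m h
  rw [map_sub, map_add, map_smul, map_smul, map_smul, hm, hm', smul_zero, smul_zero, add_zero,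
    sub_eq_zero] at h2
  rw [h2, LinearMap.smul_apply, smul_eq_mul, smul_eq_mul, mul_comm]

/-- A conic that contains three points of a line contains the line. -/
theorem IsPointEnumeration.exists_factor (hv : IsPointEnumeration F v) (h3 : finrank F V = 3)
    {ℓ : Dual F V} (hℓ : ℓ ≠ 0) {Q : QuadraticForm F V} {e₁ e₂ e₃ : E} (h12 : e₁ ≠ e₂)
    (h13 : e₁ ≠ e₃) (h23 : e₂ ≠ e₃) (hℓ₁ : ℓ (v e₁) = 0) (hℓ₂ : ℓ (v e₂) = 0)
    (hℓ₃ : ℓ (v e₃) = 0) (hQ₁ : Q (v e₁) = 0) (hQ₂ : Q (v e₂) = 0) (hQ₃ : Q (v e₃) = 0) :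
    ∃ m : Dual F V, ∀ x, Q x = ℓ x * m x := by
  have hcomb : ∀ a b : F, Q (a • v e₁ + b • v e₂) =
      a * b * QuadraticMap.polar Q (v e₁) (v e₂) := by
    intro a b
    rw [QuadraticMap.map_add Q, QuadraticMap.map_smul, QuadraticMap.map_smul, hQ₁, hQ₂,
      QuadraticMap.polar_smul_left, QuadraticMap.polar_smul_right]
    simp [mul_assoc]
  -- On the line, `Q` is the product of the two coordinates times a polar value. Both coordinates of
  -- the third point are nonzero, so this value is zero.
  have hker : ∀ x, ℓ x = 0 → Q x = 0 := by
    have hpolar : QuadraticMap.polar Q (v e₁) (v e₂) = 0 := by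
      obtain ⟨a, b, hab⟩ := hv.exists_eq_of_mem_ker h3 hℓ h12 hℓ₁ hℓ₂ hℓ₃
      have h := hcomb a b
      rw [← hab, hQ₃] at h
      have ha : a ≠ 0 := by
        rintro rfl
        rw [zero_smul, zero_add] at hab
        exact h23 (hv.injective _ _ _ hab).symm
      have hb : b ≠ 0 := by
        rintro rfl
        rw [zero_smul, add_zero] at hab
        exact h13 (hv.injective _ _ _ hab).symm
      exact (mul_eq_zero.1 h.symm).resolve_left (mul_ne_zero ha hb)
    intro x hx
    obtain ⟨a, b, rfl⟩ := hv.exists_eq_of_mem_ker h3 hℓ h12 hℓ₁ hℓ₂ hx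
    rw [hcomb, hpolar, mul_zero]
  obtain ⟨c, hc⟩ := exists_apply_eq_one hℓ
  -- The cofactor is read off by expanding `Q` at `x = (x - ℓ x • c) + ℓ x • c`, where the first
  -- summand lies on the line. Polar forms keep this valid in characteristic two.
  refine ⟨Q c • ℓ + (Q.polarBilin.flip c) ∘ₗ (LinearMap.id - ℓ.smulRight c), fun x => ?_⟩
  have hx : x = (x - ℓ x • c) + ℓ x • c := by abel
  have h0 : Q (x - ℓ x • c) = 0 :=
    hker _ (by rw [map_sub, map_smul, hc, smul_eq_mul, mul_one, sub_self])
  conv_lhs => rw [hx]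
  rw [QuadraticMap.map_add Q, h0, QuadraticMap.map_smul, QuadraticMap.polar_smul_right]
  simp only [LinearMap.add_apply, LinearMap.smul_apply, LinearMap.comp_apply,
    LinearMap.sub_apply, LinearMap.id_apply, LinearMap.smulRight_apply, LinearMap.flip_apply,
    QuadraticMap.polarBilin_apply_apply, smul_eq_mul]
  ring

theorem exists_mul_ne_zero {ℓ m : Dual F V} (hℓ : ℓ ≠ 0) (hm : m ≠ 0) :
    ∃ x, ℓ x * m x ≠ 0 := by
  obtain ⟨x, hx⟩ := DFunLike.ne_iff.1 hℓ
  obtain ⟨y, hy⟩ := DFunLike.ne_iff.1 hm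
  by_cases h1 : m x = 0
  · by_cases h2 : ℓ y = 0
    · exact ⟨x + y, by rw [map_add, map_add, h1, h2, add_zero, zero_add]; exact mul_ne_zero hx hy⟩
    · exact ⟨y, mul_ne_zero h2 hy⟩
  · exact ⟨x, mul_ne_zero hx h1⟩

/-- Five points on two independent conics are not in general position. -/
theorem IsPointEnumeration.exists_three_collinear (hv : IsPointEnumeration F v)
    (h3 : finrank F V = 3) {Q Q' : QuadraticForm F V}
    (hQ : ∀ a b : F, a • Q + b • Q' = 0 → a = 0 ∧ b = 0) (p : Fin 5 → E)
    (hp : Function.Injective p) (hQp : ∀ i, Q (v (p i)) = 0) (hQp' : ∀ i, Q' (v (p i)) = 0) :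
    ∃ ℓ : Dual F V, ℓ ≠ 0 ∧ ∃ i j k, i ≠ j ∧ i ≠ k ∧ j ≠ k ∧
      ℓ (v (p i)) = 0 ∧ ℓ (v (p j)) = 0 ∧ ℓ (v (p k)) = 0 := by
  have hpne : ∀ {i j}, i ≠ j → p i ≠ p j := fun h h' => h (hp h')
  obtain ⟨ℓ, hℓ, h0, h1⟩ := exists_dual_ne_zero h3 (v (p 0)) (v (p 1))
  by_contra! hcon
  have hoff : ∀ i, i ≠ 0 → i ≠ 1 → ℓ (v (p i)) ≠ 0 := fun i hi0 hi1 =>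
    hcon ℓ hℓ 0 1 i (by decide) hi0.symm hi1.symm h0 h1
  have hlin := LinearIndependent.pair_iff.1
    (hv.linearIndependent (hpne (show (0 : Fin 5) ≠ 1 by decide)))
  -- The sum represents a third point `r` on the line through the first two points. The member of
  -- the pencil through `r` contains this line, so its other factor vanishes at the remaining three
  -- points.
  have hsum : v (p 0) + v (p 1) ≠ 0 := by
    intro h
    have := hlin 1 1 (by simpa using h)
    exact one_ne_zero this.1
  obtain ⟨r, c, hc, hr⟩ := hv.surjective _ hsum
  have hr0 : r ≠ p 0 := by
    rintro rfl
    have := hlin (c - 1) c (Eq.trans (by module) (sub_eq_zero.2 hr.symm))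
    exact hc this.2
  have hr1 : r ≠ p 1 := by
    rintro rfl
    have := hlin c (c - 1) (Eq.trans (by module) (sub_eq_zero.2 hr.symm))
    exact hc this.1
  have hℓr : ℓ (v r) = 0 := by rw [hr, map_smul, map_add, h0, h1, add_zero, smul_zero]
  obtain ⟨a, b, hab, hvan⟩ : ∃ a b : F, ¬ (a = 0 ∧ b = 0) ∧ a * Q (v r) + b * Q' (v r) = 0 := by
    by_cases hz : Q (v r) = 0
    · exact ⟨1, 0, by simp, by simp [hz]⟩
    · exact ⟨Q' (v r), -Q (v r), by simp [hz], by ring⟩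
  obtain ⟨m, hm⟩ := hv.exists_factor h3 hℓ (Q := a • Q + b • Q')
    (hpne (show (0 : Fin 5) ≠ 1 by decide)) hr0.symm hr1.symm h0 h1 hℓr
    (by simp [hQp, hQp']) (by simp [hQp, hQp']) (by simpa using hvan)
  have hm0 : m ≠ 0 := by
    rintro rfl
    refine hab (hQ a b ?_)
    ext x
    rw [hm]
    simp
  have hmp : ∀ i, i ≠ 0 → i ≠ 1 → m (v (p i)) = 0 := by
    intro i hi0 hi1
    have := hm (v (p i))
    simp only [add_apply, smul_apply, hQp, hQp', smul_zero,
      add_zero] at this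
    exact (mul_eq_zero.1 this.symm).resolve_left (hoff i hi0 hi1)
  exact hcon m hm0 2 3 4 (by decide) (by decide) (by decide) (hmp 2 (by decide) (by decide))
    (hmp 3 (by decide) (by decide)) (hmp 4 (by decide) (by decide))

/-- The base points of a pencil of conics with at least five base points lie on a line, with at
most one exception. -/
theorem IsPointEnumeration.exists_line_of_pencil (hv : IsPointEnumeration F v)
    (h3 : finrank F V = 3) {Q Q' : QuadraticForm F V}
    (hQ : ∀ a b : F, a • Q + b • Q' = 0 → a = 0 ∧ b = 0) (X : Finset E) (hX : 5 ≤ X.card)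
    (hQX : ∀ e ∈ X, Q (v e) = 0) (hQX' : ∀ e ∈ X, Q' (v e) = 0) :
    ∃ ℓ : Dual F V, ℓ ≠ 0 ∧
      ∀ e ∈ X, ∀ e' ∈ X, ℓ (v e) ≠ 0 → ℓ (v e') ≠ 0 → e = e' := by
  let p : Fin 5 → E := fun i => (X.equivFin.symm (Fin.castLE hX i)).1
  have hpX : ∀ i, p i ∈ X := fun i => (X.equivFin.symm (Fin.castLE hX i)).2
  have hp : Function.Injective p := fun i j h =>
    Fin.castLE_injective hX (X.equivFin.symm.injective (Subtype.ext h))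
  obtain ⟨ℓ, hℓ, i, j, k, hij, hik, hjk, hi, hj, hk⟩ := hv.exists_three_collinear h3 hQ p hp
    (fun i => hQX _ (hpX i)) (fun i => hQX' _ (hpX i))
  have hpne : ∀ {i j}, i ≠ j → p i ≠ p j := fun h h' => h (hp h')
  obtain ⟨m, hm⟩ := hv.exists_factor h3 hℓ (hpne hij) (hpne hik) (hpne hjk) hi hj hk
    (hQX _ (hpX i)) (hQX _ (hpX j)) (hQX _ (hpX k))
  obtain ⟨m', hm'⟩ := hv.exists_factor h3 hℓ (hpne hij) (hpne hik) (hpne hjk) hi hj hk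
    (hQX' _ (hpX i)) (hQX' _ (hpX j)) (hQX' _ (hpX k))
  refine ⟨ℓ, hℓ, fun e he e' he' hne hne' => ?_⟩
  -- Both conics split off `ℓ`. Two distinct common points off `ℓ` would make the other factors
  -- proportional, hence also the conics.
  by_contra hee
  have hmz : ∀ e ∈ X, ℓ (v e) ≠ 0 → m (v e) = 0 := fun e he hne =>
    (mul_eq_zero.1 ((hm _).symm.trans (hQX e he))).resolve_left hne
  have hmz' : ∀ e ∈ X, ℓ (v e) ≠ 0 → m' (v e) = 0 := fun e he hne =>
    (mul_eq_zero.1 ((hm' _).symm.trans (hQX' e he))).resolve_left hne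
  have hm0 : m ≠ 0 := by
    rintro rfl
    have := hQ 1 0 (by ext x; simp [hm])
    exact one_ne_zero this.1
  obtain ⟨a, rfl⟩ := hv.exists_eq_smul_dual h3 hm0 hee (hmz e he hne) (hmz e' he' hne')
    (hmz' e he hne) (hmz' e' he' hne')
  have := hQ a (-1) (by
    ext x
    simp [hm, hm']
    ring)
  exact neg_ne_zero.2 one_ne_zero this.2

/-- A set of points is dependent if some conic contains all other points. -/
def ConicDependent (v : E → V) (τ : Finset E) : Prop :=
  ∃ Q : QuadraticForm F V, Q ≠ 0 ∧ ∀ e ∉ τ, Q (v e) = 0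

variable [Fintype E] [DecidableEq E]

/-- The points on the line with equation `ℓ`. -/
def linePoints (v : E → V) (ℓ : Dual F V) : Finset E :=
  open Classical in Finset.univ.filter fun e => ℓ (v e) = 0

theorem mem_linePoints {ℓ : Dual F V} {e : E} : e ∈ linePoints v ℓ ↔ ℓ (v e) = 0 := by
  simp [linePoints]

theorem ne_zero_of_eq_mul {Q : QuadraticForm F V} {ℓ m : Dual F V} (hQ : Q ≠ 0)
    (h : ∀ x, Q x = ℓ x * m x) : m ≠ 0 := by
  rintro rfl
  refine hQ ?_
  ext x
  simp [h]

theorem linMulLin_ne_zero {ℓ m : Dual F V} (hℓ : ℓ ≠ 0) (hm : m ≠ 0) :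
    QuadraticMap.linMulLin ℓ m ≠ 0 := by
  intro h
  obtain ⟨x, hx⟩ := exists_mul_ne_zero hℓ hm
  exact hx (by rw [← QuadraticMap.linMulLin_apply, h, zero_apply])

/-- Sets whose complement has at least five points and is not the union of a line and a point have
no Koszul homology. -/
theorem IsPointEnumeration.finrank_koszulHomology_eq_zero {K : Type*} [Field K]
    (hv : IsPointEnumeration F v) (h3 : finrank F V = 3) {σ : Finset E} {q : ℕ} (hq : 3 ≤ q)
    (hcard : σᶜ.card = q + 2)
    (hline : ∀ ℓ : Dual F V, ℓ ≠ 0 → (linePoints v ℓ).card = q + 1)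
    (hσ : ∀ ℓ : Dual F V, ℓ ≠ 0 → ∀ e₀ ∉ linePoints v ℓ, σᶜ ≠ insert e₀ (linePoints v ℓ)) :
    finrank K (KoszulHomology K (ConicDependent (F := F) v) (subsetDegree σ)) = 0 := by
  refine _root_.finrank_koszulHomology_eq_zero ?_
  rintro e he e' he' hne ⟨Q, hQ0, hQ⟩ ⟨Q', hQ0', hQ'⟩
  have hQX : ∀ x ∈ σᶜ, Q (v x) = 0 := fun x hx =>
    hQ x fun h => (Finset.mem_compl.1 hx) (Finset.mem_of_mem_erase h)
  have hQX' : ∀ x ∈ σᶜ, Q' (v x) = 0 := fun x hx =>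
    hQ' x fun h => (Finset.mem_compl.1 hx) (Finset.mem_of_mem_erase h)
  have hindep : ¬ ∀ a b : F, a • Q + b • Q' = 0 → a = 0 ∧ b = 0 := by
    intro hind
    obtain ⟨ℓ, hℓ, huniq⟩ := hv.exists_line_of_pencil h3 hind σᶜ (by omega) hQX hQX'
    have hex : ∃ e₀ ∈ σᶜ, ℓ (v e₀) ≠ 0 := by
      by_contra! h
      have := Finset.card_le_card (fun x hx => mem_linePoints.2 (h x hx) : σᶜ ⊆ linePoints v ℓ)
      rw [hline ℓ hℓ] at this
      omega
    obtain ⟨e₀, he₀, hne₀⟩ := hex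
    have hnot : e₀ ∉ linePoints v ℓ := fun h => hne₀ (mem_linePoints.1 h)
    refine hσ ℓ hℓ e₀ hnot (Finset.eq_of_subset_of_card_le (fun x hx => ?_) ?_)
    · rw [Finset.mem_insert, mem_linePoints]
      by_cases hx0 : ℓ (v x) = 0
      · exact Or.inr hx0
      · exact Or.inl (huniq x hx e₀ he₀ hx0 hne₀)
    · rw [Finset.card_insert_of_notMem hnot, hline ℓ hℓ, hcard]
  -- The two conics are proportional, so the first one also passes through `e'` and witnesses the
  -- edge.
  push Not at hindep
  obtain ⟨a, b, hab, hab0⟩ := hindep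
  have heval : ∀ x, a * Q x + b * Q' x = 0 := fun x => by
    have := congrArg (fun R : QuadraticForm F V => R x) hab
    simpa using this
  have hb : b ≠ 0 := by
    rintro rfl
    by_cases ha : a = 0
    · exact hab0 ha rfl
    · refine hQ0 ?_
      ext x
      simpa [ha] using heval x
  refine ⟨Q, hQ0, fun x hx => ?_⟩
  by_cases hmem : x ∈ σ.erase e
  · have hxe : x = e' := by
      by_contra h
      exact hx (Finset.mem_erase.2 ⟨h, hmem⟩)
    subst hxe
    have ha : a ≠ 0 := by
      rintro rfl
      refine hQ0' ?_
      ext x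
      simpa [hb] using heval x
    have := heval (v x)
    rw [hQ' x (Finset.notMem_erase _ _), mul_zero, add_zero] at this
    exact (mul_eq_zero.1 this).resolve_left ha
  · exact hQ x hmem

/-- The dimension of the Koszul homology in the degree of the complement of a line and a point. -/
theorem IsPointEnumeration.finrank_koszulHomology_add_one {K : Type*} [Field K]
    (hv : IsPointEnumeration F v) (h3 : finrank F V = 3) {ℓ : Dual F V} (hℓ : ℓ ≠ 0) {e₀ : E}
    (he₀ : ℓ (v e₀) ≠ 0) (hcard : 3 ≤ (linePoints v ℓ).card) :
    finrank K (KoszulHomology K (ConicDependent (F := F) v)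
      (subsetDegree (Finset.univ \ insert e₀ (linePoints v ℓ)))) + 1 =
      (linePoints v ℓ).card := by
  set D := linePoints v ℓ with hD
  set σ := Finset.univ \ insert e₀ D with hσ
  have hmemσ : ∀ e, e ∈ σ ↔ e ≠ e₀ ∧ ℓ (v e) ≠ 0 := by
    intro e
    rw [hσ, Finset.mem_sdiff, Finset.mem_insert, hD, mem_linePoints]
    simp
  -- Components are labelled by central projection from `e₀` to the line `ℓ`; outside `σ` the label
  -- is arbitrary.
  have hproj : ∀ e, ∃ d : D, e ∈ σ →
      ∃ c : F, c ≠ 0 ∧ v d = c • (ℓ (v e₀) • v e - ℓ (v e) • v e₀) := by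
    intro e
    by_cases he : e ∈ σ
    · have hu : ℓ (v e₀) • v e - ℓ (v e) • v e₀ ≠ 0 := by
        intro h
        refine ((hmemσ e).1 he).1 (hv.injective e e₀ ((ℓ (v e₀))⁻¹ * ℓ (v e)) ?_)
        rw [mul_smul, ← sub_eq_zero.1 h, smul_smul, inv_mul_cancel₀ he₀, one_smul]
      obtain ⟨d, c, hc, hd⟩ := hv.surjective _ hu
      refine ⟨⟨d, mem_linePoints.2 ?_⟩, fun _ => ⟨c, hc, hd⟩⟩
      rw [hd]
      simp [mul_comm]
    · obtain ⟨d, hd⟩ := Finset.card_pos.1 (show 0 < D.card by omega)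
      exact ⟨⟨d, hd⟩, fun h => absurd h he⟩
  choose κ hκ using hproj
  have hD0 : ∀ d : D, ℓ (v d) = 0 := fun d => mem_linePoints.1 d.2
  have hne_point : ∀ d : D, e₀ ≠ d := by
    rintro d rfl
    exact he₀ (hD0 d)
  have hmκ : ∀ m : Dual F V, m (v e₀) = 0 → ∀ e ∈ σ, m (v e) = 0 ↔ m (v (κ e)) = 0 := by
    intro m hm e he
    obtain ⟨c, hc, hd⟩ := hκ e he
    rw [hd, map_smul, map_sub, map_smul, map_smul, hm]
    simp [hc, he₀]
  have hdep : ∀ e ∈ σ, ∀ e' ∈ σ, κ e = κ e' →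
      ConicDependent (F := F) v ((σ.erase e).erase e') := by
    intro e he e' he' heq
    obtain ⟨m, hm, hm0, hmd⟩ := exists_dual_ne_zero h3 (v e₀) (v (κ e))
    refine ⟨QuadraticMap.linMulLin ℓ m, linMulLin_ne_zero hℓ hm, fun x hx => ?_⟩
    rw [QuadraticMap.linMulLin_apply, mul_eq_zero]
    by_cases hx1 : x = e'
    · rw [hx1, hmκ m hm0 e' he', ← heq]
      exact Or.inr hmd
    by_cases hx2 : x = e
    · rw [hx2, hmκ m hm0 e he]
      exact Or.inr hmd
    have hx3 : x ∉ σ := fun h => hx (Finset.mem_erase.2 ⟨hx1, Finset.mem_erase.2 ⟨hx2, h⟩⟩)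
    rw [hmemσ] at hx3
    by_cases hx4 : x = e₀
    · rw [hx4]
      exact Or.inr hm0
    · exact Or.inl (by_contra fun h => hx3 ⟨hx4, h⟩)
  have : Nonempty D := (Finset.card_pos.1 (show 0 < D.card by omega)).to_subtype
  rw [_root_.finrank_koszulHomology_add_one (ι := D) κ, Fintype.card_coe]
  · intro e he
    simpa using hdep e he e he rfl
  · intro d
    have hlin := LinearIndependent.pair_iff.1 (hv.linearIndependent (hne_point d))
    -- A third point on the line joining `e₀` and `d` lies in `σ` and projects to `d`.
    have hsum : v e₀ + v d ≠ 0 := fun h =>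
      one_ne_zero (hlin 1 1 (by simpa using h)).1
    obtain ⟨e, c, hc, he⟩ := hv.surjective _ hsum
    have hmem : e ∈ σ := by
      rw [hmemσ]
      constructor
      · rintro rfl
        exact hc (hlin (c - 1) c (Eq.trans (by module) (sub_eq_zero.2 he.symm))).2
      · rw [he, map_smul, map_add, hD0, add_zero]
        exact mul_ne_zero hc he₀
    refine ⟨e, hmem, ?_⟩
    obtain ⟨c', hc', hd⟩ := hκ e hmem
    refine Subtype.ext (hv.injective _ _ (c' * ℓ (v e₀) * c) ?_)
    rw [hd, he, map_smul, map_add, hD0]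
    simp only [add_zero, smul_eq_mul]
    module
  · intro e he e' he' hne
    refine ⟨?_, hdep e he e' he'⟩
    rintro ⟨Q, hQ0, hQ⟩
    have hout : ∀ x, x ∉ σ → Q (v x) = 0 := fun x hx =>
      hQ x fun h => hx (Finset.mem_of_mem_erase (Finset.mem_of_mem_erase h))
    obtain ⟨d₁, hd₁, d₂, hd₂, d₃, hd₃, h12, h13, h23⟩ := Finset.two_lt_card.1
      (show 2 < D.card by omega)
    have hDout : ∀ d ∈ D, d ∉ σ := fun d hd h => ((hmemσ d).1 h).2 (mem_linePoints.1 hd)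
    obtain ⟨m, hm⟩ := hv.exists_factor h3 hℓ h12 h13 h23 (mem_linePoints.1 hd₁)
      (mem_linePoints.1 hd₂) (mem_linePoints.1 hd₃) (hout _ (hDout _ hd₁)) (hout _ (hDout _ hd₂))
      (hout _ (hDout _ hd₃))
    have hmz : ∀ x, ℓ (v x) ≠ 0 → Q (v x) = 0 → m (v x) = 0 := fun x hx hQx =>
      (mul_eq_zero.1 ((hm _).symm.trans hQx)).resolve_left hx
    have hm0 := hmz e₀ he₀ (hout e₀ fun h => ((hmemσ e₀).1 h).1 rfl)
    have hme := hmz e ((hmemσ e).1 he).2 (hQ e (by simp))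
    have hme' := hmz e' ((hmemσ e').1 he').2 (hQ e' (by simp))
    -- With distinct projections, the second factor `m` vanishes at two points of `ℓ`, so it is a
    -- multiple of `ℓ`. As it vanishes at `e₀`, it is zero.
    by_contra hκne
    obtain ⟨a, rfl⟩ := hv.exists_eq_smul_dual h3 hℓ
      (fun h => hκne (Subtype.ext h)) (hD0 (κ e)) (hD0 (κ e'))
      ((hmκ m hm0 e he).1 hme) ((hmκ m hm0 e' he').1 hme')
    refine ne_zero_of_eq_mul hQ0 hm ?_
    rw [LinearMap.smul_apply, smul_eq_mul, mul_eq_zero] at hm0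
    rw [hm0.resolve_right he₀, zero_smul]

end Conics

/-! ### The Veronese matroid in terms of conics, and the counts of lines and points -/

section VeroneseMatroid

open Module

variable {F : Type*} [Field F]

theorem isPointEnumeration_rep {E V : Type*} [AddCommGroup V] [Module F V] (P : E ≃ ℙ F V) :
    IsPointEnumeration F fun e => (P e).rep where
  ne_zero e := (P e).rep_nonzero
  injective e e' c h := by
    refine P.injective ?_
    rw [← (P e).mk_rep, ← (P e').mk_rep, Projectivization.mk_eq_mk_iff']
    exact ⟨c, h.symm⟩
  surjective u hu := by
    obtain ⟨a, ha⟩ := Projectivization.exists_smul_eq_mk_rep F u hu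
    refine ⟨P.symm (Projectivization.mk F u hu), a, a.ne_zero, ?_⟩
    rw [Equiv.apply_symm_apply, ← ha, Units.smul_def]

/-- The quadratic form with a given coefficient vector. -/
def conicForm (g : Fin 6 → F) : QuadraticForm F (Fin 3 → F) :=
  g 0 • QuadraticMap.linMulLin (LinearMap.proj 0) (LinearMap.proj 0) +
  g 1 • QuadraticMap.linMulLin (LinearMap.proj 0) (LinearMap.proj 1) +
  g 2 • QuadraticMap.linMulLin (LinearMap.proj 0) (LinearMap.proj 2) +
  g 3 • QuadraticMap.linMulLin (LinearMap.proj 1) (LinearMap.proj 1) +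
  g 4 • QuadraticMap.linMulLin (LinearMap.proj 1) (LinearMap.proj 2) +
  g 5 • QuadraticMap.linMulLin (LinearMap.proj 2) (LinearMap.proj 2)

theorem conicForm_apply (g : Fin 6 → F) (x : Fin 3 → F) :
    conicForm g x = ∑ i, g i * veroneseVec x i := by
  simp [conicForm, veroneseVec, Fin.sum_univ_succ, sq]
  ring

/-- The mixed coefficients are polar values of basis vectors, which needs no division by two. -/
theorem exists_conicForm_eq (Q : QuadraticForm F (Fin 3 → F)) : ∃ g, conicForm g = Q := by
  let b : Fin 3 → Fin 3 → F := fun i => Pi.single i 1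
  refine ⟨![Q (b 0), QuadraticMap.polar Q (b 0) (b 1), QuadraticMap.polar Q (b 0) (b 2),
    Q (b 1), QuadraticMap.polar Q (b 1) (b 2), Q (b 2)], ?_⟩
  ext x
  have hx : x = x 0 • b 0 + x 1 • b 1 + x 2 • b 2 := by
    funext i
    fin_cases i <;> simp [b]
  conv_rhs => rw [hx]
  rw [QuadraticMap.map_add Q, QuadraticMap.map_add Q, QuadraticMap.polar_add_left,
    conicForm_apply]
  simp [QuadraticMap.map_smul, QuadraticMap.polar_smul_left, QuadraticMap.polar_smul_right,
    Fin.sum_univ_succ, veroneseVec]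
  ring

theorem IsVeroneseGeneratorMatrix.exists_scalars {E : Type*} {P : E ≃ ℙ F (Fin 3 → F)}
    {G : Matrix (Fin 6) E F} (hG : IsVeroneseGeneratorMatrix P G) (e : E) :
    ∃ c : F, c ≠ 0 ∧ ∀ i, G i e = c * veroneseVec (P e).rep i := by
  obtain ⟨h, hmk⟩ := hG e
  obtain ⟨c, hc⟩ := (Projectivization.mk_eq_mk_iff F _ _ _ _).1 hmk
  exact ⟨c, c.ne_zero, fun i => (congrFun hc i).symm⟩

/-- A linear relation among the columns of `H` in `τ` is a code word supported in `τ`, that is, up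
to nonzero factors in each coordinate, the values of a conic that vanishes outside `τ`. -/
theorem columnMatroid_dep_iff {n r : ℕ} {P : Fin n ≃ ℙ F (Fin 3 → F)}
    {G : Matrix (Fin 6) (Fin n) F} (hG : IsVeroneseGeneratorMatrix P G)
    {H : Matrix (Fin r) (Fin n) F} (hH : IsParityCheckMatrix H (rowCode G))
    (τ : Finset (Fin n)) :
    (columnMatroid H).Dep (τ : Set (Fin n)) ↔
      ConicDependent (F := F) (fun e => (P e).rep) τ := by
  choose c hc hGc using hG.exists_scalars
  have hcode : ∀ x, H *ᵥ x = 0 ↔ ∃ g, ∀ e, x e = c e * conicForm g (P e).rep := by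
    intro x
    rw [← hH, rowCode, Submodule.mem_span_range_iff_exists_fun]
    refine exists_congr fun g => ?_
    rw [funext_iff]
    refine forall_congr' fun e => ?_
    have : (∑ i, g i • G.row i) e = c e * conicForm g (P e).rep := by
      rw [Finset.sum_apply, conicForm_apply, Finset.mul_sum]
      refine Finset.sum_congr rfl fun i _ => ?_
      rw [Pi.smul_apply, smul_eq_mul, Matrix.row, hGc]
      ring
    rw [this, eq_comm]
  have hdep : (columnMatroid H).Dep (τ : Set (Fin n)) ↔ ¬ LinearIndepOn F H.col τ := by
    rw [Matroid.Dep, columnMatroid_indep_iff]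
    exact and_iff_left (Set.subset_univ _)
  rw [hdep, linearIndepOn_finset_iff]
  push Not
  constructor
  · rintro ⟨x, hx, e, he, hne⟩
    have hker : H *ᵥ (fun e => if e ∈ τ then x e else 0) = 0 := by
      rw [mulVec_eq_sum_col]
      simpa [Finset.sum_ite_mem, ite_smul] using hx
    obtain ⟨g, hg⟩ := (hcode _).1 hker
    refine ⟨conicForm g, fun h => hne ?_, fun e' he' => ?_⟩
    · have := hg e
      rwa [if_pos he, h, zero_apply, mul_zero] at this
    · have := hg e'
      rw [if_neg he'] at this
      exact (mul_eq_zero.1 this.symm).resolve_left (hc e')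
  · rintro ⟨Q, hQ0, hQ⟩
    obtain ⟨g, rfl⟩ := exists_conicForm_eq Q
    obtain ⟨u, hu⟩ := DFunLike.ne_iff.1 hQ0
    have hu0 : u ≠ 0 := by
      rintro rfl
      exact hu (by simp)
    obtain ⟨e, a, ha, hea⟩ := (isPointEnumeration_rep P).surjective u hu0
    have hne : conicForm g (P e).rep ≠ 0 := by
      change (P e).rep = _ at hea
      rw [hea, QuadraticMap.map_smul]
      exact mul_ne_zero (mul_ne_zero ha ha) hu
    have hker := (hcode fun e => c e * conicForm g (P e).rep).2 ⟨g, fun _ => rfl⟩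
    refine ⟨fun e => c e * conicForm g (P e).rep, ?_, e, by_contra fun h => hne (hQ e h),
      mul_ne_zero (hc e) hne⟩
    rw [mulVec_eq_sum_col] at hker
    rw [← hker]
    refine Finset.sum_subset (Finset.subset_univ τ) fun i _ hi => ?_
    change (c i * conicForm g (P i).rep) • H.col i = 0
    rw [show conicForm g (P i).rep = 0 from hQ i hi, mul_zero, zero_smul]

theorem card_points_plane [Fintype F] {n : ℕ} (P : Fin n ≃ ℙ F (Fin 3 → F)) :
    n = Fintype.card F ^ 2 + Fintype.card F + 1 := by
  have h := Projectivization.card_of_finrank F (Fin 3 → F) (n := 3) (by simp)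
  rw [← Nat.card_congr P, Nat.card_fin, Nat.card_eq_fintype_card] at h
  rw [h]
  simp [Finset.sum_range_succ]
  ring

theorem dual_rep_eq_zero_iff {V : Type*} [AddCommGroup V] [Module F V] (ℓ : Dual F V) {u : V}
    (hu : u ≠ 0) : ℓ (Projectivization.mk F u hu).rep = 0 ↔ ℓ u = 0 := by
  obtain ⟨a, ha⟩ := Projectivization.exists_smul_eq_mk_rep F u hu
  rw [← ha, Units.smul_def, map_smul, smul_eq_mul, mul_eq_zero, or_iff_right a.ne_zero]

/-- The points of the line correspond to the projectivization of the two-dimensional kernel of `ℓ`.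
-/
theorem card_linePoints [Fintype F] {n : ℕ} (P : Fin n ≃ ℙ F (Fin 3 → F))
    {ℓ : Dual F (Fin 3 → F)} (hℓ : ℓ ≠ 0) :
    (linePoints (fun e => (P e).rep) ℓ).card = Fintype.card F + 1 := by
  have h := Projectivization.card_of_finrank_two F (LinearMap.ker ℓ)
    (finrank_ker_dual (by simp) hℓ)
  rw [Nat.card_eq_fintype_card (α := F)] at h
  rw [← h, ← Nat.card_eq_finsetCard]
  have hinj := (LinearMap.ker ℓ).injective_subtype
  have hmem : ∀ x : ℙ F (LinearMap.ker ℓ),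
      P.symm (Projectivization.map (LinearMap.ker ℓ).subtype hinj x) ∈
        linePoints (fun e => (P e).rep) ℓ := by
    intro x
    rw [mem_linePoints, Equiv.apply_symm_apply]
    induction x with | h u hu =>
    rw [Projectivization.map_mk, dual_rep_eq_zero_iff]
    exact u.2
  symm
  refine Nat.card_eq_of_bijective (fun x => ⟨_, hmem x⟩) ⟨fun x y hxy => ?_, fun e => ?_⟩
  · exact Projectivization.map_injective _ hinj (P.symm.injective (congrArg Subtype.val hxy))
  · have he : (P e).rep ∈ LinearMap.ker ℓ :=
      (mem_linePoints (v := fun e => (P e).rep)).1 e.2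
    refine ⟨Projectivization.mk F ⟨(P e).rep, he⟩ fun h => (P e).rep_nonzero
      (congrArg Subtype.val h), Subtype.ext ?_⟩
    change P.symm _ = e.1
    rw [Projectivization.map_mk, Equiv.symm_apply_eq]
    exact (P e).mk_rep

theorem linePoints_smul {E V : Type*} [AddCommGroup V] [Module F V] [Fintype E] [DecidableEq E]
    (v : E → V) (ℓ : Dual F V) {a : F} (ha : a ≠ 0) : linePoints v (a • ℓ) = linePoints v ℓ := by
  ext e
  simp [mem_linePoints, ha]

theorem linePoints_rep_mk {E V : Type*} [AddCommGroup V] [Module F V] [Fintype E] [DecidableEq E]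
    (v : E → V) {ℓ : Dual F V} (hℓ : ℓ ≠ 0) :
    linePoints v (Projectivization.mk F ℓ hℓ).rep = linePoints v ℓ := by
  obtain ⟨a, ha⟩ := Projectivization.exists_smul_eq_mk_rep F ℓ hℓ
  rw [← ha, Units.smul_def, linePoints_smul v ℓ a.ne_zero]

/-- The complements of the unions of a line and a point outside it. -/
def flagComplements [Fintype F] {n : ℕ} (P : Fin n ≃ ℙ F (Fin 3 → F)) :
    Finset (Finset (Fin n)) :=
  open Classical in
  (Set.toFinite {σ | ∃ ℓ : Dual F (Fin 3 → F), ℓ ≠ 0 ∧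
    ∃ e₀ ∉ linePoints (fun e => (P e).rep) ℓ,
      σ = Finset.univ \ insert e₀ (linePoints (fun e => (P e).rep) ℓ)}).toFinset

theorem mem_flagComplements [Fintype F] {n : ℕ} {P : Fin n ≃ ℙ F (Fin 3 → F)}
    {σ : Finset (Fin n)} : σ ∈ flagComplements P ↔ ∃ ℓ : Dual F (Fin 3 → F), ℓ ≠ 0 ∧
    ∃ e₀ ∉ linePoints (fun e => (P e).rep) ℓ,
      σ = Finset.univ \ insert e₀ (linePoints (fun e => (P e).rep) ℓ) := by
  simp [flagComplements]

theorem card_flagComplements [Fintype F] {n : ℕ} (P : Fin n ≃ ℙ F (Fin 3 → F)) :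
    (flagComplements P).card =
      (Fintype.card F ^ 2 + Fintype.card F + 1) * Fintype.card F ^ 2 := by
  classical
  have hv := isPointEnumeration_rep P
  set v : Fin n → Fin 3 → F := fun e => (P e).rep
  have : Finite (Dual F (Fin 3 → F)) := Module.finite_of_finite F
  have : Fintype (ℙ F (Dual F (Fin 3 → F))) := Fintype.ofFinite _
  have hlines : Fintype.card (ℙ F (Dual F (Fin 3 → F))) =
      Fintype.card F ^ 2 + Fintype.card F + 1 := by
    have h := Projectivization.card_of_finrank F (Dual F (Fin 3 → F)) (n := 3)
      (by rw [Subspace.dual_finrank_eq]; simp)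
    rw [Nat.card_eq_fintype_card, Nat.card_eq_fintype_card] at h
    rw [h]
    simp [Finset.sum_range_succ]
    ring
  have hline : ∀ l : ℙ F (Dual F (Fin 3 → F)), (linePoints v l.rep).card = Fintype.card F + 1 :=
    fun l => card_linePoints P l.rep_nonzero
  let flags := (Finset.univ : Finset (ℙ F (Dual F (Fin 3 → F)))).sigma
    fun l => (linePoints v l.rep)ᶜ
  have hflags : flags.card =
      (Fintype.card F ^ 2 + Fintype.card F + 1) * Fintype.card F ^ 2 := by
    rw [Finset.card_sigma]
    simp_rw [Finset.card_compl, hline]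
    rw [Finset.sum_const, smul_eq_mul, Finset.card_univ, hlines, Fintype.card_fin,
      card_points_plane P]
    congr 1
    omega
  rw [← hflags]
  symm
  refine Finset.card_bij (fun p _ => Finset.univ \ insert p.2 (linePoints v p.1.rep)) ?_ ?_ ?_
  · rintro ⟨l, e⟩ h
    exact mem_flagComplements.2 ⟨l.rep, l.rep_nonzero, e,
      Finset.mem_compl.1 (Finset.mem_sigma.1 h).2, rfl⟩
  · rintro ⟨l, e⟩ h ⟨l', e'⟩ h' heq
    have he : e ∉ linePoints v l.rep := Finset.mem_compl.1 (Finset.mem_sigma.1 h).2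
    have he' : e' ∉ linePoints v l'.rep := Finset.mem_compl.1 (Finset.mem_sigma.1 h').2
    have hset : insert e (linePoints v l.rep) = insert e' (linePoints v l'.rep) := by
      have := congrArg (fun s => Finset.univ \ s) heq
      simpa using this
    have hF : 1 < Fintype.card F := Fintype.one_lt_card
    -- A line has at least three points, so two of them differ from `e'` and lie on both lines; this
    -- forces the lines, and then the points, to agree.
    have hinter : 1 < ((linePoints v l.rep).erase e').card := by
      have := Finset.pred_card_le_card_erase (s := linePoints v l.rep) (a := e')
      rw [hline] at this
      omega
    obtain ⟨x, hx, y, hy, hxy⟩ := Finset.one_lt_card.1 hinter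
    have hmem : ∀ z ∈ (linePoints v l.rep).erase e', z ∈ linePoints v l'.rep := by
      intro z hz
      have : z ∈ insert e' (linePoints v l'.rep) := by
        rw [← hset]
        exact Finset.mem_insert_of_mem (Finset.mem_of_mem_erase hz)
      exact (Finset.mem_insert.1 this).resolve_left (Finset.ne_of_mem_erase hz)
    obtain ⟨a, ha⟩ := hv.exists_eq_smul_dual (by simp) l'.rep_nonzero hxy
      (mem_linePoints.1 (hmem x hx)) (mem_linePoints.1 (hmem y hy))
      (mem_linePoints.1 (Finset.mem_of_mem_erase hx))
      (mem_linePoints.1 (Finset.mem_of_mem_erase hy))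
    have hl : l = l' := by
      rw [← l.mk_rep, ← l'.mk_rep, Projectivization.mk_eq_mk_iff']
      exact ⟨a, ha.symm⟩
    subst hl
    have : e ∈ insert e' (linePoints v l.rep) := hset ▸ Finset.mem_insert_self _ _
    rw [(Finset.mem_insert.1 this).resolve_right he]
  · intro σ hσ
    obtain ⟨ℓ, hℓ, e₀, he₀, rfl⟩ := mem_flagComplements.1 hσ
    refine ⟨⟨Projectivization.mk F ℓ hℓ, e₀⟩, ?_, ?_⟩
    · rw [Finset.mem_sigma, Finset.mem_compl, linePoints_rep_mk]
      exact ⟨Finset.mem_univ _, he₀⟩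
    · rw [linePoints_rep_mk]

theorem weight_fineWeight {E : Type*} (m : E →₀ ℕ) : Finsupp.weight (fineWeight E) m = m := by
  rw [Finsupp.weight_apply]
  conv_rhs => rw [← Finsupp.sum_single m]
  refine Finset.sum_congr rfl fun e _ => ?_
  simp [fineWeight]

theorem weight_standardWeight {E : Type*} (m : E →₀ ℕ) :
    Finsupp.weight (standardWeight E) m = m.degree := by
  rw [Finsupp.degree_eq_weight_one]
  rfl

theorem degree_subsetDegree {E : Type*} (σ : Finset E) : (subsetDegree σ).degree = σ.card := by
  unfold subsetDegree
  rw [map_sum]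
  simp

theorem hasGradedBettiNumber_two {n r : ℕ} {P : Fin n ≃ ℙ F (Fin 3 → F)}
    {G : Matrix (Fin 6) (Fin n) F} (hG : IsVeroneseGeneratorMatrix P G)
    {H : Matrix (Fin r) (Fin n) F} (hH : IsParityCheckMatrix H (rowCode G))
    {K : Type*} [Field K] {A : Type*} [AddCommMonoid A] [DecidableEq A] {w : Fin n → A}
    (hw : ∀ m : Fin n →₀ ℕ, Finsupp.weight w m = 0 → m = 0) (g : A) :
    HasGradedBettiNumber w (stanleyReisnerIdeal K (columnMatroid H)) 2 g
      (∑ σ : Finset (Fin n), if Finsupp.weight w (subsetDegree σ) = g then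
        finrank K (KoszulHomology K (ConicDependent (F := F) fun e => (P e).rep)
          (subsetDegree σ)) else 0) := by
  have hI : ∀ f, f ∈ stanleyReisnerIdeal K (columnMatroid H) ↔
      ∀ m ∈ f.support, ConicDependent (F := F) (fun e => (P e).rep) m.support := by
    intro f
    rw [mem_stanleyReisnerIdeal_iff rfl]
    exact forall₂_congr fun m _ => columnMatroid_dep_iff hG hH _
  have hempty : ¬ ConicDependent (F := F) (fun e => (P e).rep) ∅ := by
    rw [← columnMatroid_dep_iff hG hH, Finset.coe_empty]
    exact (columnMatroid H).empty_indep.not_dep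
  refine ⟨nonempty_minimalGradedFreeResolution w (fun f hf m => ?_) (fun f hf => ?_), fun Φ =>
    Φ.multiplicity_two hw (fun σ τ hle => ?_) hempty hI g⟩
  · rw [hI]
    intro m' hm'
    rw [MvPolynomial.mem_support_iff, MvPolynomial.coeff_monomial] at hm'
    split_ifs at hm' with h
    · exact (hI f).1 hf m' (MvPolynomial.mem_support_iff.2 (h ▸ hm'))
    · exact absurd rfl hm'
  · by_contra hne
    exact hempty (by simpa using (hI f).1 hf 0 (MvPolynomial.mem_support_iff.2 hne))
  · rintro ⟨Q, hQ0, hQ⟩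
    exact ⟨Q, hQ0, fun e he => hQ e fun h => he (hle h)⟩

end VeroneseMatroid

theorem proposition3p6 {F : Type*} [Field F] [Fintype F] (q : ℕ) (hq : Fintype.card F = q)
    (hq4 : 4 ≤ q) {n : ℕ} (P : Fin n ≃ ℙ F (Fin 3 → F))
    (G : Matrix (Fin 6) (Fin n) F) (hG : IsVeroneseGeneratorMatrix P G)
    {r : ℕ} (H : Matrix (Fin r) (Fin n) F) (hH : IsParityCheckMatrix H (rowCode G))
    (K : Type*) [Field K] :
    (∀ L : Projectivization.Subspace F (Fin 3 → F), Module.finrank F L.submodule = 2 →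
      ∀ D : Finset (Fin n), (∀ e ∈ D, P e ∈ L) → D.card = q + 1 →
      ∀ e₀ : Fin n, P e₀ ∉ L →
        HasFineBettiNumber K (columnMatroid H) 2 (Finset.univ \ (insert e₀ D)) q) ∧
    HasStandardBettiNumber K (columnMatroid H) 2 (q ^ 2 - 1) (q ^ 3 * (q ^ 2 + q + 1)) := by
  subst hq
  set q := Fintype.card F with hq
  have hv := isPointEnumeration_rep P
  have h3 : Module.finrank F (Fin 3 → F) = 3 := by simp
  have hline := fun (ℓ : Module.Dual F (Fin 3 → F)) (hℓ : ℓ ≠ 0) => card_linePoints P hℓ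
  have hdim : ∀ ℓ : Module.Dual F (Fin 3 → F), ℓ ≠ 0 → ∀ e₀ ∉ linePoints (fun e => (P e).rep) ℓ,
      Module.finrank K (KoszulHomology K (ConicDependent (F := F) fun e => (P e).rep)
        (subsetDegree (Finset.univ \ insert e₀ (linePoints (fun e => (P e).rep) ℓ)))) = q := by
    intro ℓ hℓ e₀ he₀
    have h := hv.finrank_koszulHomology_add_one (K := K) h3 hℓ
      (fun h => he₀ (mem_linePoints.2 h)) (by rw [hline ℓ hℓ]; omega)
    rw [hline ℓ hℓ] at h
    exact Nat.add_right_cancel h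
  refine ⟨fun L hL D hDL hD e₀ he₀ => ?_, ?_⟩
  · have hlt : L.submodule < ⊤ := by
      refine lt_top_iff_ne_top.2 fun h => ?_
      rw [h, finrank_top, h3] at hL
      omega
    obtain ⟨ℓ, hℓ, hle⟩ := Submodule.exists_le_ker_of_lt_top _ hlt
    -- The `q + 1` points of `D` lie on the line of `ℓ`, which has no more than that.
    have hDℓ : D = linePoints (fun e => (P e).rep) ℓ := by
      refine Finset.eq_of_subset_of_card_le (fun e he => ?_) (by rw [hline ℓ hℓ, hD])
      refine mem_linePoints.2 (hle ((L.mem_submodule_iff (P e).rep_nonzero).2 ?_))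
      rw [(P e).mk_rep]
      exact hDL e he
    have he₀' : e₀ ∉ linePoints (fun e => (P e).rep) ℓ := fun h => he₀ (hDL e₀ (hDℓ ▸ h))
    have h := hasGradedBettiNumber_two hG hH (K := K) (w := fineWeight (Fin n))
      (fun m hm => by rwa [weight_fineWeight] at hm) (subsetDegree (Finset.univ \ insert e₀ D))
    -- In the fine grading only the set itself contributes to the sum.
    simp_rw [weight_fineWeight, subsetDegree_injective.eq_iff] at h
    rw [Finset.sum_ite_eq', if_pos (Finset.mem_univ _), hDℓ, hdim ℓ hℓ e₀ he₀', ← hDℓ] at h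
    exact h
  · have h := hasGradedBettiNumber_two hG hH (K := K) (w := standardWeight (Fin n))
      (fun m hm => by rwa [weight_standardWeight, Finsupp.degree_eq_zero_iff] at hm) (q ^ 2 - 1)
    have hn : n = q ^ 2 + q + 1 := card_points_plane P
    have hq2 : 1 ≤ q ^ 2 := Nat.one_le_pow _ _ (by omega)
    simp_rw [weight_standardWeight, degree_subsetDegree] at h
    have hcompl : ∀ σ : Finset (Fin n), σ.card = q ^ 2 - 1 ↔ σᶜ.card = q + 2 := by
      intro σ
      have := σ.card_add_card_compl
      rw [Fintype.card_fin] at this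
      omega
    -- Among the sets of size `q² - 1`, with complements of size `q + 2`, only the complements of a
    -- line and a point off it contribute.
    rw [← Finset.sum_filter, ← Finset.sum_subset (s₁ := flagComplements P)] at h
    · rw [Finset.sum_congr rfl (g := fun _ => q)] at h
      · rw [Finset.sum_const, card_flagComplements, smul_eq_mul] at h
        rw [show q ^ 3 * (q ^ 2 + q + 1) = (q ^ 2 + q + 1) * q ^ 2 * q by ring]
        exact h
      · intro σ hσ
        obtain ⟨ℓ, hℓ, e₀, he₀, rfl⟩ := mem_flagComplements.1 hσ
        exact hdim ℓ hℓ e₀ he₀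
    · intro σ hσ
      obtain ⟨ℓ, hℓ, e₀, he₀, rfl⟩ := mem_flagComplements.1 hσ
      rw [Finset.mem_filter, hcompl, ← Finset.compl_eq_univ_sdiff, compl_compl,
        Finset.card_insert_of_notMem he₀, hline ℓ hℓ]
      exact ⟨Finset.mem_univ _, rfl⟩
    · intro σ hσ hσ'
      rw [Finset.mem_filter, hcompl] at hσ
      refine hv.finrank_koszulHomology_eq_zero h3 (by omega) hσ.2 hline
        fun ℓ hℓ e₀ he₀ heq => hσ' (mem_flagComplements.2 ⟨ℓ, hℓ, e₀, he₀, ?_⟩)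
      rw [← heq, ← Finset.compl_eq_univ_sdiff, compl_compl]

end
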